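/- Let $K=\{x_1,\dots,x_N\}$ be a finite set of $N$ distinct points, so that $C(K)=\mathbb R^K$, and let $V=\{V(x)\}_{x\in K}$ be a spectral process on $K$, i.e. a non-negative stochastic process with $\mathbb E\,V(x)=1$ for all $x\in K$. Let $\Gamma_1<\Gamma_2<\cdots$ be the arrival times of a unit rate Poisson process on $(0,\infty)$, and let $V_1,V_2,\dots$ be independent copies of $V$, independent of $(\Gamma_j)_{j}$. Put $\varphi_j=\Gamma_j^{-1}V_j$ and let $$Z(x)=\max_{j\in\mathbb N}\varphi_j(x),\qquad x\in K,$$ be the associated simple max-stable process. For $k=1,\dots,N$ let $\varphi_+^{(k)}$ be the ($k$-th extremal) function, almost surely unique, among the $\varphi_j$ with $\varphi_+^{(k)}(x_k)=\max_{j\in\mathbb N}\varphi_j(x_k)$, and for $1\le n\le N$ let $$Z_+^{(n)}(x)=\max_{k=1,\dots,n}\varphi_+^{(k)}(x),\qquad x\in K .$$ **Proposition.** Let $1\le n\le N$. For every measurable function $f:C(K)\times K\to[0,\infty]$, $$\mathbb P\bigl\{|Z(x)-Z_+^{(n)}(x)|>f(Z_+^{(n)},x)\text{ for some }x\in K\bigr\}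 =1-\mathbb E_{Z_+^{(n)}}\Bigl\{\exp\Bigl(-\mathbb E_V\Bigl\{\sup_{x\in K}\frac{V(x)}{Z_+^{(n)}(x)+f(Z_+^{(n)},x)}-\max_{i=1,\dots,n}\frac{V(x_i)}{Z_+^{(n)}(x_i)}\Bigr\}_+\Bigr)\Bigr\},$$ where, on the right-hand side, the spectral process $V$ and the process $Z_+^{(n)}$ are stochastically independent (so that $\mathbb E_V$ is the expectation over $V$ with $Z_+^{(n)}$ held fixed), $\{a\}_+=\max\{a,0\}$, and the conventions $a/0=\infty$ for $a>0$, $0/0=0$, $a/\infty=0$ for $0\le a<\infty$ and $\exp(-\infty)=0$ are used. -/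

import Mathlib

open MeasureTheory ProbabilityTheory
open scoped ENNReal

namespace MaxStable

/-- A spectral process on a finite domain `K` (where every function is continuous, so that
`C(K) = (K → ℝ)`): a non-negative process with unit mean at every point. -/
structure IsSpectral {K Ω' : Type*} [MeasurableSpace Ω'] (V : Ω' → K → ℝ)
    (Q : Measure Ω') : Prop where
  measurable : Measurable V
  nonneg : ∀ᵐ ω ∂Q, ∀ y, 0 ≤ V ω y
  mean_one : ∀ y, ∫ ω, V ω y ∂Q = 1

/-- The interarrival times of a sequence of arrival times: `Γ 0`, `Γ 1 - Γ 0`, `Γ 2 - Γ 1`, … -/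
def interarrival {Ω : Type*} (Γ : ℕ → Ω → ℝ) : ℕ → Ω → ℝ
  | 0 => Γ 0
  | j + 1 => fun ω => Γ (j + 1) ω - Γ j ω

/-- `Γ 0 < Γ 1 < …` are the arrival times of a unit rate Poisson process on `(0, ∞)`:
the interarrival times are independent standard exponential random variables. -/
structure IsUnitPoissonArrivals {Ω : Type*} [MeasurableSpace Ω] (Γ : ℕ → Ω → ℝ)
    (P : Measure Ω) : Prop where
  measurable : ∀ j, Measurable (Γ j)
  indep : iIndepFun (interarrival Γ) P
  exponential : ∀ j, P.map (interarrival Γ j) = expMeasure 1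

/-- `W 0, W 1, …` are independent copies of the process `V`, independent of the arrival times
`Γ 0, Γ 1, …` of a unit rate Poisson process. -/
structure IsMarkedPoisson {K Ω Ω' : Type*} [MeasurableSpace Ω] [MeasurableSpace Ω']
    (Γ : ℕ → Ω → ℝ) (W : ℕ → Ω → K → ℝ) (P : Measure Ω)
    (V : Ω' → K → ℝ) (Q : Measure Ω') : Prop where
  arrivals : IsUnitPoissonArrivals Γ P
  measurable : ∀ j, Measurable (W j)
  law : ∀ j, P.map (W j) = Q.map V
  indep_marks : iIndepFun W P
  indep_arrivals : IndepFun (fun ω j => Γ j ω) (fun ω j => W j ω) P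

/-- The functions `φ_j = Γ_j⁻¹ W_j` of the Poisson point process. -/
noncomputable def spectralFunctions {K Ω : Type*} (Γ : ℕ → Ω → ℝ) (W : ℕ → Ω → K → ℝ) (ω : Ω) :
    ℕ → K → ℝ :=
  fun j y => (Γ j ω)⁻¹ * W j ω y

/-- The pointwise maximum `max_j φ_j`. -/
noncomputable def pointwiseMax {K : Type*} (φ : ℕ → K → ℝ) : K → ℝ :=
  fun y => ⨆ j, φ j y

/-- The index of the function that attains the maximum `max_j φ_j(y)` (almost surely there is
exactly one; the smallest one is chosen otherwise, and `0` if there is none). -/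
noncomputable def extremalIndex {K : Type*} (φ : ℕ → K → ℝ) (y : K) : ℕ :=
  sInf {j | ∀ i, φ i y ≤ φ j y}

/-- The extremal function at `y`: the `φ_j` with `φ_j(y) = max_i φ_i(y)`. -/
noncomputable def extremalFunction {K : Type*} (φ : ℕ → K → ℝ) (y : K) : K → ℝ :=
  φ (extremalIndex φ y)

/-- The maximum of the extremal functions at the points `x 0, …, x (n - 1)`. -/
noncomputable def extremalMax {K : Type*} {n : ℕ} (φ : ℕ → K → ℝ) (x : Fin n → K) : K → ℝ :=
  fun y => ⨆ i, extremalFunction φ (x i) y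

/-- The max-stable process `Z = max_j Γ_j⁻¹ W_j`. -/
noncomputable def maxStableField {K Ω : Type*} (Γ : ℕ → Ω → ℝ) (W : ℕ → Ω → K → ℝ) (ω : Ω) :
    K → ℝ :=
  pointwiseMax (spectralFunctions Γ W ω)

/-- The intermediate approximation `Z₊⁽ⁿ⁾`, the maximum of the first `n` extremal functions, where
the domain `K = {x 0, …, x (N - 1)}` is enumerated by `x`. -/
noncomputable def intermediateField {K Ω : Type*} {N : ℕ} (Γ : ℕ → Ω → ℝ) (W : ℕ → Ω → K → ℝ)
    (x : Fin N ≃ K) (n : ℕ) (hn : n ≤ N) (ω : Ω) : K → ℝ :=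
  extremalMax (spectralFunctions Γ W ω) (fun i : Fin n => x (Fin.castLE hn i))

end MaxStable

open MeasureTheory ProbabilityTheory
open scoped ENNReal

namespace MaxStable

/-! The pairs `(Γ_j, W_j)` form a Poisson process on `(0, ∞) × (K → ℝ)` with intensity Lebesgue
times the law of `V`. A nonzero gap between `Z` and `Z₊⁽ⁿ⁾` comes from non-extremal functions, so
the event says that some `φ_j` lies strictly below `Z₊⁽ⁿ⁾` at the first `n` points and above `Z₊⁽ⁿ⁾
+ f` somewhere (`IsRegularSeq.exists_lt_iff`). Conditionally on the extremal functions, the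
remaining points are a Poisson process restricted to the functions below `Z₊⁽ⁿ⁾` at these points, so
the conditional probability that none exceeds is `exp (-Λ)`, with `Λ` the intensity of the
exceedance set (`IsMecke.lintegral_voidSet_hitMax`). For a fixed `w`, the admissible `t` in `w / t`
fill an interval from `max_i w(x_i) / z(x_i)` to `sup_y w(y) / (z(y) + f(z, y))`; its length is the
truncated difference in the formula (`intensity_exceedanceSet`).

All Poisson properties are drawn from one identity, the Mecke equation `IsMecke` for an enumerated
point process. It is proved from exponential gaps: deleting the `j`-th arrival merges two gaps into
one, within which the deleted point is uniformly placed; summing over `j` makes the gaps tile `(0,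
∞)`. The equation yields void probabilities, local finiteness and the absence of ties.

The conditional statement is an induction on the set of points at which extremal functions are
collected. Mecke's equation removes the function maximal at a new point `x`. This turns the rest
into the same problem, with a larger lower bound `z` and a larger region `U` known to be empty, so
both are kept general. The exceedance set lies strictly below the running maximum at `x`, hence it
does not meet the newly forbidden region and its intensity is unaffected. -/

/-! ### Deleting and inserting a term of a sequence. -/

/-- The increasing enumeration of `ℕ \ {j}`. -/
def skip (j l : ℕ) : ℕ := if l < j then l else l + 1

lemma skip_of_lt {j l : ℕ} (h : l < j) : skip j l = l := if_pos h

lemma skip_of_le {j l : ℕ} (h : j ≤ l) : skip j l = l + 1 := if_neg h.not_gt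

lemma skip_ne (j l : ℕ) : skip j l ≠ j := by
  unfold skip; split_ifs <;> omega

lemma skip_injective (j : ℕ) : Function.Injective (skip j) := by
  intro a b h
  unfold skip at h; split_ifs at h <;> omega

lemma exists_skip_eq {j l : ℕ} (h : l ≠ j) : ∃ m, skip j m = l := by
  rcases lt_or_gt_of_ne h with h | h
  · exact ⟨l, skip_of_lt h⟩
  · exact ⟨l - 1, by rw [skip_of_le (by omega)]; omega⟩

lemma forall_iff_skip {P : ℕ → Prop} (j : ℕ) : (∀ l, P l) ↔ P j ∧ ∀ l, P (skip j l) := by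
  refine ⟨fun h => ⟨h _, fun l => h _⟩, fun ⟨h, h'⟩ l => ?_⟩
  rcases eq_or_ne l j with rfl | hl
  · exact h
  · obtain ⟨m, rfl⟩ := exists_skip_eq hl
    exact h' m

lemma tsum_eq_add_tsum_skip (g : ℕ → ℝ≥0∞) (j : ℕ) : ∑' l, g l = g j + ∑' l, g (skip j l) := by
  rw [ENNReal.tsum_eq_add_tsum_ite j]
  congr 1
  have h := (skip_injective j).tsum_eq (f := fun l => if l = j then 0 else g l) fun l hl =>
    exists_skip_eq (by rintro rfl; simp at hl)
  simp only [skip_ne, if_false] at h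
  rw [h]
  exact tsum_congr fun l => by congr

/-- The sequence `r` with the value `a` inserted at position `j`. -/
def insertAt {α : Type*} (j : ℕ) (a : α) (r : ℕ → α) (l : ℕ) : α :=
  if l < j then r l else if l = j then a else r (l - 1)

section insertAt

variable {α : Type*}

@[simp] lemma insertAt_self (j : ℕ) (a : α) (r : ℕ → α) : insertAt j a r j = a := by
  simp [insertAt]

@[simp] lemma insertAt_skip (j : ℕ) (a : α) (r : ℕ → α) (l : ℕ) :
    insertAt j a r (skip j l) = r l := by
  rcases lt_or_ge l j with h | h
  · simp [insertAt, skip_of_lt h, h]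
  · rw [skip_of_le h, insertAt, if_neg (by omega), if_neg (by omega), Nat.add_sub_cancel]

lemma measurable_insertAt [MeasurableSpace α] (j : ℕ) :
    Measurable fun q : α × (ℕ → α) => insertAt j q.1 q.2 := by
  refine measurable_pi_lambda _ fun l => ?_
  unfold insertAt
  split_ifs <;> fun_prop

/-- An i.i.d. sequence stays i.i.d. when an independent copy of its terms is inserted at any
position. On cylinders the factor of coordinate `j` splits off, and the other factors are reindexed
by `skip j`. -/
lemma map_insertAt_prod_infinitePi [MeasurableSpace α] (ν : Measure α) [IsProbabilityMeasure ν]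
    (j : ℕ) :
    (ν.prod (Measure.infinitePi fun _ : ℕ => ν)).map (fun q => insertAt j q.1 q.2) =
      Measure.infinitePi fun _ : ℕ => ν := by
  classical
  refine Measure.eq_infinitePi _ fun s t ht => ?_
  rw [Measure.map_apply (measurable_insertAt j)
    (MeasurableSet.pi s.countable_toSet fun i _ => ht i)]
  have hset : (fun q : α × (ℕ → α) => insertAt j q.1 q.2) ⁻¹' (Set.pi s t) =
      (if j ∈ s then t j else Set.univ) ×ˢ
        Set.pi (s.preimage (skip j) (skip_injective j).injOn) (fun l => t (skip j l)) := by
    ext q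
    simp only [Set.mem_preimage, Set.mem_pi, Finset.mem_coe, Set.mem_prod, Finset.mem_preimage]
    rw [forall_iff_skip j]
    simp only [insertAt_self, insertAt_skip]
    refine and_congr_left fun _ => ?_
    split_ifs with h <;> simp [h]
  rw [hset, Measure.prod_prod, Measure.infinitePi_pi _ (fun i _ => ht _),
    Finset.prod_preimage' (skip j) s (skip_injective j).injOn (fun l => ν (t l)),
    ← Finset.prod_filter_not_mul_prod_filter s (· ∈ Set.range (skip j)) (fun l => ν (t l))]
  congr 1
  have : s.filter (fun l => l ∉ Set.range (skip j)) = if j ∈ s then {j} else ∅ := by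
    ext l
    have : l ∉ Set.range (skip j) ↔ l = j := by
      refine ⟨fun h => by_contra fun h' => h (exists_skip_eq h'), ?_⟩
      rintro rfl ⟨m, hm⟩
      exact skip_ne _ _ hm
    rw [Finset.mem_filter, this]
    split_ifs with h
    · simp only [Finset.mem_singleton]; constructor
      · exact fun h => h.2
      · rintro rfl; exact ⟨h, rfl⟩
    · simp only [Finset.notMem_empty, iff_false]; rintro ⟨h1, rfl⟩; exact h h1
  rw [this]
  split_ifs <;> simp

lemma lintegral_infinitePi_eq_insertAt [MeasurableSpace α] (ν : Measure α)
    [IsProbabilityMeasure ν] (j : ℕ) {G : (ℕ → α) → ℝ≥0∞} (hG : Measurable G) :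
    ∫⁻ e, G e ∂(Measure.infinitePi fun _ : ℕ => ν) =
      ∫⁻ a, ∫⁻ r, G (insertAt j a r) ∂(Measure.infinitePi fun _ : ℕ => ν) ∂ν := by
  conv_lhs => rw [← map_insertAt_prod_infinitePi ν j]
  rw [lintegral_map hG (measurable_insertAt j),
    lintegral_prod (fun q : α × (ℕ → α) => G (insertAt j q.1 q.2))
      (hG.comp (measurable_insertAt j)).aemeasurable]

end insertAt

/-! ### Arrival times with independent exponential gaps. -/

lemma sum_range_insertAt_of_le (j m : ℕ) (h : m ≤ j) (a : ℝ) (r : ℕ → ℝ) :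
    ∑ i ∈ Finset.range m, insertAt j a r i = ∑ i ∈ Finset.range m, r i := by
  refine Finset.sum_congr rfl fun i hi => ?_
  rw [Finset.mem_range] at hi
  rw [insertAt, if_pos (by omega)]

lemma sum_range_succ_insertAt_of_le (j m : ℕ) (h : j ≤ m) (a : ℝ) (r : ℕ → ℝ) :
    ∑ i ∈ Finset.range (m + 1), insertAt j a r i = a + ∑ i ∈ Finset.range m, r i := by
  induction m, h using Nat.le_induction with
  | base =>
    rw [Finset.sum_range_succ, sum_range_insertAt_of_le _ _ le_rfl, insertAt_self, add_comm]
  | succ m hm ih =>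
    rw [Finset.sum_range_succ, ih, Finset.sum_range_succ, ← skip_of_le hm, insertAt_skip, add_assoc]

/-- The arrival times with given interarrival times. -/
noncomputable def arrival (e : ℕ → ℝ) (l : ℕ) : ℝ := ∑ i ∈ Finset.range (l + 1), e i

lemma measurable_arrival : Measurable arrival := by
  refine measurable_pi_lambda _ fun l => ?_
  unfold arrival
  fun_prop

/-- Deleting the `j`-th arrival merges the gaps `a` and `b` on its two sides into the single gap `a
+ b` and leaves every other arrival in place. -/
lemma arrival_insertAt_insertAt_skip (j l : ℕ) (a b : ℝ) (s : ℕ → ℝ) :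
    arrival (insertAt j a (insertAt j b s)) (skip j l) = arrival (insertAt j (a + b) s) l := by
  unfold arrival
  rcases lt_or_ge l j with h | h
  · rw [skip_of_lt h, sum_range_insertAt_of_le _ _ h, sum_range_insertAt_of_le _ _ h,
      sum_range_insertAt_of_le _ _ h]
  · rw [skip_of_le h, sum_range_succ_insertAt_of_le _ _ (by omega),
      sum_range_succ_insertAt_of_le _ _ h, sum_range_succ_insertAt_of_le _ _ h, add_assoc]

lemma lintegral_expMeasure_one (f : ℝ → ℝ≥0∞) (hf : Measurable f) :
    ∫⁻ a, f a ∂(expMeasure 1) =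
      ∫⁻ a, (Set.Ioi 0).indicator (fun a => ENNReal.ofReal (Real.exp (-a)) * f a) a := by
  have h0 : expMeasure 1 = volume.withDensity (exponentialPDF 1) := rfl
  have hm : Measurable (exponentialPDF 1) := (measurable_exponentialPDFReal 1).ennreal_ofReal
  rw [h0, lintegral_withDensity_eq_lintegral_mul _ hm hf]
  -- The exponential density does not vanish at `0`, whereas the indicator of the open half-line
  -- does; a single point is negligible.
  have : ∀ᵐ a : ℝ, a ≠ 0 := by simp [ae_iff]
  refine lintegral_congr_ae ?_
  filter_upwards [this] with a ha
  rw [Pi.mul_apply, exponentialPDF_eq]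
  rcases lt_or_gt_of_ne ha with h | h
  · simp [h.not_ge, h.le]
  · simp [h.le, h]

instance : IsProbabilityMeasure (expMeasure 1) := isProbabilityMeasure_expMeasure one_pos

/-- In the variables `a` and `c = a + b` the joint density `exp (-a) exp (-b)` becomes `exp (-c)` on
`0 < a < c`: it no longer depends on `a`, so Lebesgue measure on the merged gap appears. -/
lemma lintegral_expMeasure_expMeasure_shear {H : ℝ → ℝ → ℝ≥0∞}
    (hH : Measurable (Function.uncurry H)) :
    ∫⁻ a, ∫⁻ b, H a (a + b) ∂(expMeasure 1) ∂(expMeasure 1) =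
      ∫⁻ b, (∫⁻ a in Set.Ioc 0 b, H a b) ∂(expMeasure 1) := by
  have hH' : ∀ {β : Type} [MeasurableSpace β] {u v : β → ℝ}, Measurable u → Measurable v →
      Measurable fun x => H (u x) (v x) := fun hu hv => hH.comp (hu.prodMk hv)
  have hexp : Measurable fun b : ℝ => ENNReal.ofReal (Real.exp (-b)) := by fun_prop
  have hT : MeasurableSet {q : ℝ × ℝ | 0 < q.1 ∧ q.1 < q.2} :=
    (measurableSet_lt measurable_const measurable_fst).inter
      (measurableSet_lt measurable_fst measurable_snd)
  set T : Set (ℝ × ℝ) := {q : ℝ × ℝ | 0 < q.1 ∧ q.1 < q.2} with hTdef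
  have hF : Measurable (T.indicator fun q => ENNReal.ofReal (Real.exp (-q.2)) * H q.1 q.2) :=
    ((hexp.comp measurable_snd).mul (hH' measurable_fst measurable_snd)).indicator hT
  have hin : Measurable fun a => ∫⁻ b, H a (a + b) ∂(expMeasure 1) := by
    have : Measurable (Function.uncurry fun a b => H a (a + b)) :=
      hH' measurable_fst (measurable_fst.add measurable_snd)
    exact this.lintegral_prod_right
  have hIoc : ∀ b, ∫⁻ a in Set.Ioc 0 b, H a b = ∫⁻ a, T.indicator (fun q => H q.1 q.2) (a, b) := by
    intro b
    rw [← setLIntegral_congr (Ioo_ae_eq_Ioc (μ := volume)), ← lintegral_indicator measurableSet_Ioo]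
    rfl
  have hin2 : Measurable fun b => ∫⁻ a, (T.indicator fun q => H q.1 q.2) (a, b) := by
    have h1 : Measurable (T.indicator fun q => H q.1 q.2) :=
      (hH' measurable_fst measurable_snd).indicator hT
    exact (h1.comp measurable_swap).lintegral_prod_right'
  have hL : ∫⁻ a, ∫⁻ b, H a (a + b) ∂(expMeasure 1) ∂(expMeasure 1) =
      ∫⁻ a, ∫⁻ b, T.indicator (fun q => ENNReal.ofReal (Real.exp (-q.2)) * H q.1 q.2) (a, b) := by
    rw [lintegral_expMeasure_one _ hin]
    refine lintegral_congr fun a => ?_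
    by_cases ha : 0 < a
    · rw [Set.indicator_of_mem (by exact ha), lintegral_expMeasure_one (fun b => H a (a + b))
          (hH' measurable_const (measurable_const.add measurable_id)),
        ← lintegral_const_mul' _ _ ENNReal.ofReal_ne_top,
        ← lintegral_add_left_eq_self (fun b =>
          T.indicator (fun q => ENNReal.ofReal (Real.exp (-q.2)) * H q.1 q.2) (a, b)) a]
      refine lintegral_congr fun b => ?_
      by_cases hb : 0 < b
      · rw [Set.indicator_of_mem (by exact hb),
          Set.indicator_of_mem (show (a, a + b) ∈ T from ⟨ha, by simpa using hb⟩), ← mul_assoc,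
          ← ENNReal.ofReal_mul (Real.exp_pos _).le, ← Real.exp_add]
        congr 3
        ring
      · rw [Set.indicator_of_notMem (by exact hb), mul_zero,
          Set.indicator_of_notMem (fun h : (a, a + b) ∈ T => hb (by simpa using h.2))]
    · rw [Set.indicator_of_notMem (by exact ha)]
      refine (lintegral_eq_zero_of_ae_eq_zero (ae_of_all _ fun b => ?_)).symm
      exact Set.indicator_of_notMem (fun h : (a, b) ∈ T => ha h.1) _
  rw [hL, lintegral_lintegral_swap (f := fun a b =>
    T.indicator (fun q => ENNReal.ofReal (Real.exp (-q.2)) * H q.1 q.2) (a, b)) hF.aemeasurable]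
  simp_rw [hIoc]
  rw [lintegral_expMeasure_one _ hin2]
  refine lintegral_congr fun b => ?_
  by_cases hb : 0 < b
  · rw [Set.indicator_of_mem (by exact hb), ← lintegral_const_mul' _ _ ENNReal.ofReal_ne_top]
    refine lintegral_congr fun a => ?_
    by_cases h : (a, b) ∈ T
    · rw [Set.indicator_of_mem h, Set.indicator_of_mem h]
    · rw [Set.indicator_of_notMem h, Set.indicator_of_notMem h, mul_zero]
  · rw [Set.indicator_of_notMem (by exact hb)]
    refine lintegral_eq_zero_of_ae_eq_zero (ae_of_all _ fun a => ?_)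
    exact Set.indicator_of_notMem (fun h : (a, b) ∈ T => hb (h.1.trans h.2)) _

/-- The law of the interarrival times of a unit rate Poisson process. -/
noncomputable def interarrivalLaw : Measure (ℕ → ℝ) := Measure.infinitePi fun _ => expMeasure 1

instance : IsProbabilityMeasure interarrivalLaw := by unfold interarrivalLaw; infer_instance

/-- The Mecke formula for the `j`-th arrival time. -/
lemma lintegral_arrival_skip (j : ℕ) {G : ℝ → (ℕ → ℝ) → ℝ≥0∞}
    (hG : Measurable (Function.uncurry G)) :
    ∫⁻ e, G (arrival e j) (fun l => arrival e (skip j l)) ∂interarrivalLaw =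
      ∫⁻ e, (∫⁻ t in Set.Ioc (∑ i ∈ Finset.range j, e i) (∑ i ∈ Finset.range (j + 1), e i),
        G t (arrival e)) ∂interarrivalLaw := by
  have hG' : ∀ {β : Type} [MeasurableSpace β] {u : β → ℝ} {v : β → ℕ → ℝ}, Measurable u →
      Measurable v → Measurable fun x => G (u x) (v x) := fun hu hv => hG.comp (hu.prodMk hv)
  have hsum : ∀ m, Measurable fun e : ℕ → ℝ => ∑ i ∈ Finset.range m, e i := fun m => by fun_prop
  have hskip : Measurable fun e : ℕ → ℝ => fun l => arrival e (skip j l) :=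
    measurable_pi_lambda _ fun l => (measurable_pi_apply _).comp measurable_arrival
  have hm1 : Measurable fun e : ℕ → ℝ => G (arrival e j) (fun l => arrival e (skip j l)) :=
    hG' ((measurable_pi_apply _).comp measurable_arrival) hskip
  have hIoc : ∀ e : ℕ → ℝ,
      ∫⁻ t in Set.Ioc (∑ i ∈ Finset.range j, e i) (∑ i ∈ Finset.range (j + 1), e i),
        G t (arrival e) =
      ∫⁻ a in Set.Ioc 0 (e j), G (∑ i ∈ Finset.range j, e i + a) (arrival e) := by
    intro e
    rw [← lintegral_indicator measurableSet_Ioc, ← lintegral_indicator measurableSet_Ioc,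
      ← lintegral_add_left_eq_self _ (∑ i ∈ Finset.range j, e i)]
    refine lintegral_congr fun a => ?_
    simp only [Set.indicator, Set.mem_Ioc, Finset.sum_range_succ, lt_add_iff_pos_right,
      add_le_add_iff_left]
  simp_rw [hIoc]
  have hm2 : Measurable fun e : ℕ → ℝ =>
      ∫⁻ a in Set.Ioc 0 (e j), G (∑ i ∈ Finset.range j, e i + a) (arrival e) := by
    have h1 : Measurable fun q : (ℕ → ℝ) × ℝ => {q : (ℕ → ℝ) × ℝ | 0 < q.2 ∧ q.2 ≤ q.1 j}.indicator
        (fun q => G (∑ i ∈ Finset.range j, q.1 i + q.2) (arrival q.1)) q := by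
      refine (hG' (((hsum j).comp measurable_fst).add measurable_snd)
        (measurable_arrival.comp measurable_fst)).indicator ?_
      exact (measurableSet_lt measurable_const measurable_snd).inter
        (measurableSet_le measurable_snd ((measurable_pi_apply j).comp measurable_fst))
    convert h1.lintegral_prod_right' (ν := volume) using 2 with e
    rw [← lintegral_indicator measurableSet_Ioc]
    rfl
  unfold interarrivalLaw at *
  rw [lintegral_infinitePi_eq_insertAt _ j hm1, lintegral_infinitePi_eq_insertAt _ j hm2]
  have hins : Measurable fun q : (ℝ × ℝ) × (ℕ → ℝ) =>
      G (∑ i ∈ Finset.range j, q.2 i + q.1.1) (arrival (insertAt j q.1.2 q.2)) := by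
    refine hG' (((hsum j).comp measurable_snd).add (measurable_fst.comp measurable_fst)) ?_
    exact measurable_arrival.comp ((measurable_insertAt j).comp
      ((measurable_snd.comp measurable_fst).prodMk measurable_snd))
  set H : ℝ → ℝ → ℝ≥0∞ := fun a b => ∫⁻ s, G (∑ i ∈ Finset.range j, s i + a)
    (arrival (insertAt j b s)) ∂(Measure.infinitePi fun _ : ℕ => expMeasure 1) with hHdef
  have hH : Measurable (Function.uncurry H) := hins.lintegral_prod_right'
  -- With gaps `a`, `b` at positions `j`, `j + 1`, deletion leaves a sequence with `j`-th gap `a +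
  -- b`, while the deleted arrival sits at distance `a` into that gap. On the right-hand side `b` is
  -- already the whole gap.
  trans ∫⁻ a, ∫⁻ b, H a (a + b) ∂(expMeasure 1) ∂(expMeasure 1)
  · refine lintegral_congr fun a => ?_
    have hmeas : Measurable fun r : ℕ → ℝ => insertAt j a r :=
      (measurable_insertAt j).comp (measurable_const.prodMk measurable_id)
    rw [lintegral_infinitePi_eq_insertAt (G := fun r => G (arrival (insertAt j a r) j)
      fun l => arrival (insertAt j a r) (skip j l)) _ j (hm1.comp hmeas)]
    refine lintegral_congr fun b => lintegral_congr fun s => ?_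
    simp only [arrival_insertAt_insertAt_skip]
    congr 1
    rw [arrival, sum_range_succ_insertAt_of_le _ _ le_rfl, sum_range_insertAt_of_le _ _ le_rfl,
      add_comm]
  · rw [lintegral_expMeasure_expMeasure_shear hH]
    refine lintegral_congr fun b => ?_
    rw [hHdef]
    simp only [insertAt_self, sum_range_insertAt_of_le _ _ le_rfl]
    rw [lintegral_lintegral_swap]
    exact (hins.comp ((measurable_fst.prodMk measurable_const).prodMk measurable_snd)).aemeasurable

lemma ae_interarrivalLaw_pos : ∀ᵐ e ∂interarrivalLaw, ∀ i, 0 < e i := by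
  refine ae_all_iff.2 fun i => ?_
  have h : ∀ᵐ a ∂(expMeasure 1), 0 < a := by
    have hm : MeasurableSet {a : ℝ | ¬ 0 < a} :=
      (measurableSet_lt measurable_const measurable_id).compl
    rw [ae_iff, ← lintegral_indicator_one hm,
      lintegral_expMeasure_one _ (measurable_one.indicator hm)]
    refine lintegral_eq_zero_of_ae_eq_zero (ae_of_all _ fun a => ?_)
    by_cases ha : 0 < a
    · simp [ha]
    · exact Set.indicator_of_notMem (by exact ha) _
  have hmap : interarrivalLaw.map (fun e => e i) = expMeasure 1 :=
    Measure.infinitePi_map_eval (fun _ : ℕ => expMeasure 1) i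
  rw [← hmap] at h
  exact ae_of_ae_map (measurable_pi_apply i).aemeasurable h

lemma lintegral_interarrivalLaw_exp_neg_sum (m : ℕ) :
    ∫⁻ e, ENNReal.ofReal (Real.exp (-∑ i ∈ Finset.range m, e i)) ∂interarrivalLaw =
      (∫⁻ a, ENNReal.ofReal (Real.exp (-a)) ∂(expMeasure 1)) ^ m := by
  have hm : ∀ m, Measurable fun e : ℕ → ℝ =>
      ENNReal.ofReal (Real.exp (-∑ i ∈ Finset.range m, e i)) := fun m => by fun_prop
  induction m with
  | zero => simp
  | succ m ih =>
    rw [interarrivalLaw, lintegral_infinitePi_eq_insertAt _ m (hm _), pow_succ', ← ih,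
      ← lintegral_mul_const _ (by fun_prop)]
    refine lintegral_congr fun a => ?_
    rw [interarrivalLaw, ← lintegral_const_mul' _ _ ENNReal.ofReal_ne_top]
    refine lintegral_congr fun r => ?_
    rw [sum_range_succ_insertAt_of_le _ _ le_rfl, neg_add, Real.exp_add,
      ENNReal.ofReal_mul (Real.exp_pos _).le]

lemma lintegral_exp_neg_expMeasure_lt_one :
    ∫⁻ a, ENNReal.ofReal (Real.exp (-a)) ∂(expMeasure 1) < 1 := by
  rw [lintegral_expMeasure_one _ (by fun_prop), lintegral_indicator measurableSet_Ioi]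
  have h : ∀ a : ℝ, ENNReal.ofReal (Real.exp (-a)) * ENNReal.ofReal (Real.exp (-a)) =
      ENNReal.ofReal (Real.exp (-2 * a)) := fun a => by
    rw [← ENNReal.ofReal_mul (Real.exp_pos _).le, ← Real.exp_add]; congr 2; ring
  simp_rw [h]
  rw [← ofReal_integral_eq_lintegral_ofReal, integral_exp_mul_Ioi (by norm_num)]
  · norm_num
  · exact integrableOn_exp_mul_Ioi (by norm_num) 0
  · exact ae_of_all _ fun _ => (Real.exp_pos _).le

/-- The expectations of `exp (-S_m)`, with `S_m` the partial sums, form a convergent geometric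
series. Hence `exp (-S_m)` tends to `0` almost surely, which a bound on the `S_m` would prevent. -/
lemma ae_interarrivalLaw_unbounded :
    ∀ᵐ e ∂interarrivalLaw, ¬ BddAbove (Set.range fun m => ∑ i ∈ Finset.range m, e i) := by
  have hfin : ∫⁻ e, ∑' m, ENNReal.ofReal (Real.exp (-∑ i ∈ Finset.range m, e i))
      ∂interarrivalLaw ≠ ∞ := by
    rw [lintegral_tsum fun m => by fun_prop]
    simp_rw [lintegral_interarrivalLaw_exp_neg_sum]
    rw [ENNReal.tsum_geometric]
    simpa using (tsub_pos_iff_lt.2 lintegral_exp_neg_expMeasure_lt_one).ne'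
  have hlt := ae_lt_top (by fun_prop) hfin
  filter_upwards [hlt] with e he hb
  obtain ⟨C, hC⟩ := hb
  have h0 := ENNReal.tendsto_atTop_zero_of_tsum_ne_top he.ne
  have : ∀ m, ENNReal.ofReal (Real.exp (-C)) ≤
      ENNReal.ofReal (Real.exp (-∑ i ∈ Finset.range m, e i)) := fun m =>
    ENNReal.ofReal_le_ofReal (Real.exp_le_exp.2 (neg_le_neg (hC ⟨m, rfl⟩)))
  have h1 := ge_of_tendsto' h0 this
  exact absurd h1 (by simpa using Real.exp_pos _)

lemma tsum_lintegral_Ioc_arrival {e : ℕ → ℝ} (hpos : ∀ i, 0 < e i)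
    (hunb : ¬ BddAbove (Set.range fun m => ∑ i ∈ Finset.range m, e i)) (g : ℝ → ℝ≥0∞) :
    ∑' j, ∫⁻ t in Set.Ioc (∑ i ∈ Finset.range j, e i) (∑ i ∈ Finset.range (j + 1), e i), g t =
      ∫⁻ t in Set.Ioi 0, g t := by
  have hmono : Monotone fun m => ∑ i ∈ Finset.range m, e i :=
    monotone_nat_of_le_succ fun m => by
      rw [Finset.sum_range_succ]; exact le_add_of_nonneg_right (hpos m).le
  have hU := iUnion_Ioc_map_succ_eq_Ioi (f := fun m => ∑ i ∈ Finset.range m, e i)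
    (fun m => hmono (Nat.zero_le m)) hunb
  have hD := hmono.pairwise_disjoint_on_Ioc_succ
  simp only [Nat.succ_eq_succ, Nat.bot_eq_zero, Finset.range_zero, Finset.sum_empty] at hU hD
  rw [← hU, lintegral_iUnion (fun _ => measurableSet_Ioc) hD]

/-! ### The Mecke equation for the marked arrival times. -/

/-- The Mecke equation, for a point process with intensity `Λ` whose points are enumerated by
a random sequence with law `M`. -/
def IsMecke {A : Type*} [MeasurableSpace A] (Λ : Measure A) (M : Measure (ℕ → A)) : Prop :=
  ∀ F : A → (ℕ → A) → ℝ≥0∞, Measurable (Function.uncurry F) →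
    ∫⁻ p, ∑' j, F (p j) (fun l => p (skip j l)) ∂M = ∫⁻ a, ∫⁻ p, F a p ∂M ∂Λ

lemma measurable_skip {A : Type*} [MeasurableSpace A] (j : ℕ) :
    Measurable fun (p : ℕ → A) l => p (skip j l) :=
  measurable_pi_lambda _ fun _ => measurable_pi_apply _

/-- For each `j`, the mark of the deleted arrival is integrated separately and the other marks are
again i.i.d., so the formula for a single arrival applies after averaging over marks. The intervals
obtained for the different `j` then tile `(0, ∞)`. -/
lemma isMecke_arrival {E : Type*} [MeasurableSpace E] (κ : Measure E) [IsProbabilityMeasure κ] :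
    IsMecke (((volume : Measure ℝ).restrict (Set.Ioi 0)).prod κ)
      ((interarrivalLaw.prod (Measure.infinitePi fun _ : ℕ => κ)).map
        fun q l => (arrival q.1 l, q.2 l)) := by
  intro F hF
  have hF' : ∀ {β : Type _} [MeasurableSpace β] {u : β → ℝ × E} {v : β → ℕ → ℝ × E},
      Measurable u → Measurable v → Measurable fun x => F (u x) (v x) :=
    fun hu hv => hF.comp (hu.prodMk hv)
  have harr : ∀ l, Measurable fun e => arrival e l := fun l =>
    (measurable_pi_apply l).comp measurable_arrival
  have hpts : Measurable fun (q : (ℕ → ℝ) × (ℕ → E)) (l : ℕ) => (arrival q.1 l, q.2 l) :=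
    measurable_pi_lambda _ fun l =>
      ((harr l).comp measurable_fst).prodMk ((measurable_pi_apply l).comp measurable_snd)
  have hzip : Measurable fun (q : (ℕ → ℝ) × (ℕ → E)) (l : ℕ) => (q.1 l, q.2 l) :=
    measurable_pi_lambda _ fun l =>
      ((measurable_pi_apply l).comp measurable_fst).prodMk
        ((measurable_pi_apply l).comp measurable_snd)
  set ρ : Measure (ℕ → E) := Measure.infinitePi fun _ : ℕ => κ with hρ
  have hFj : ∀ j, Measurable fun p : ℕ → ℝ × E => F (p j) (fun l => p (skip j l)) := fun j =>
    hF' (measurable_pi_apply j) (measurable_skip j)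
  set G : ℝ → (ℕ → ℝ) → ℝ≥0∞ := fun t a => ∫⁻ v, ∫⁻ w, F (t, v) (fun l => (a l, w l)) ∂ρ ∂κ
    with hGdef
  have hG4 : Measurable fun q : ((ℝ × (ℕ → ℝ)) × E) × (ℕ → E) =>
      F (q.1.1.1, q.1.2) (fun l => (q.1.1.2 l, q.2 l)) :=
    hF' (by fun_prop) (hzip.comp (by fun_prop :
      Measurable fun q : ((ℝ × (ℕ → ℝ)) × E) × (ℕ → E) => (q.1.1.2, q.2)))
  have hG3 : Measurable fun q : (ℝ × (ℕ → ℝ)) × E =>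
      ∫⁻ w, F (q.1.1, q.2) (fun l => (q.1.2 l, w l)) ∂ρ := hG4.lintegral_prod_right'
  have hG : Measurable (Function.uncurry G) := hG3.lintegral_prod_right'
  have hterm : ∀ j, ∫⁻ q : (ℕ → ℝ) × (ℕ → E), F (arrival q.1 j, q.2 j)
      (fun l => (arrival q.1 (skip j l), q.2 (skip j l))) ∂(interarrivalLaw.prod ρ) =
      ∫⁻ e, (∫⁻ t in Set.Ioc (∑ i ∈ Finset.range j, e i) (∑ i ∈ Finset.range (j + 1), e i),
        G t (arrival e)) ∂interarrivalLaw := by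
    intro j
    rw [lintegral_prod (fun q : (ℕ → ℝ) × (ℕ → E) => F (arrival q.1 j, q.2 j)
      (fun l => (arrival q.1 (skip j l), q.2 (skip j l)))) ((hFj j).comp hpts).aemeasurable,
      ← lintegral_arrival_skip j hG]
    refine lintegral_congr fun e => ?_
    rw [hρ, lintegral_infinitePi_eq_insertAt (G := fun w => F (arrival e j, w j)
      (fun l => (arrival e (skip j l), w (skip j l)))) κ j
      ((hFj j).comp (hpts.comp measurable_prodMk_left))]
    simp only [insertAt_self, insertAt_skip]
    rfl
  have hmeas : ∀ j, Measurable fun e : ℕ → ℝ =>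
      ∫⁻ t in Set.Ioc (∑ i ∈ Finset.range j, e i) (∑ i ∈ Finset.range (j + 1), e i),
        G t (arrival e) := by
    intro j
    have h1 : Measurable fun q : (ℕ → ℝ) × ℝ => {q : (ℕ → ℝ) × ℝ |
        ∑ i ∈ Finset.range j, q.1 i < q.2 ∧ q.2 ≤ ∑ i ∈ Finset.range (j + 1), q.1 i}.indicator
        (fun q => G q.2 (arrival q.1)) q := by
      refine Measurable.indicator (hG.comp (measurable_snd.prodMk
        (measurable_arrival.comp measurable_fst))) ?_
      exact (measurableSet_lt (by fun_prop) measurable_snd).inter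
        (measurableSet_le measurable_snd (by fun_prop))
    convert h1.lintegral_prod_right' (ν := volume) using 2 with e
    rw [← lintegral_indicator measurableSet_Ioc]
    rfl
  rw [lintegral_map (.tsum hFj) hpts, lintegral_tsum (f := fun j (q : (ℕ → ℝ) × (ℕ → E)) =>
    F (arrival q.1 j, q.2 j) (fun l => (arrival q.1 (skip j l), q.2 (skip j l))))
    fun j => ((hFj j).comp hpts).aemeasurable]
  simp_rw [hterm]
  rw [← lintegral_tsum fun j => (hmeas j).aemeasurable]
  trans ∫⁻ e, (∫⁻ t in Set.Ioi 0, G t (arrival e)) ∂interarrivalLaw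
  · refine lintegral_congr_ae ?_
    filter_upwards [ae_interarrivalLaw_pos, ae_interarrivalLaw_unbounded] with e h1 h2
    exact tsum_lintegral_Ioc_arrival h1 h2 _
  · have hFR : Measurable fun a : ℝ × E => ∫⁻ p, F a p
        ∂((interarrivalLaw.prod ρ).map fun q l => (arrival q.1 l, q.2 l)) :=
      hF.lintegral_prod_right'
    rw [lintegral_prod _ hFR.aemeasurable,
      lintegral_lintegral_swap (f := fun e t => G t (arrival e)) (hG.comp (measurable_snd.prodMk
        (measurable_arrival.comp measurable_fst))).aemeasurable]
    refine lintegral_congr fun t => ?_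
    rw [hGdef]
    dsimp only
    rw [lintegral_lintegral_swap (f := fun e v => ∫⁻ w, F (t, v) (fun l => (arrival e l, w l)) ∂ρ)
      (hG3.comp ((measurable_const.prodMk (measurable_arrival.comp measurable_fst)).prodMk
        measurable_snd)).aemeasurable]
    refine lintegral_congr fun v => ?_
    have hv : Measurable fun p => F (t, v) p := hF.comp measurable_prodMk_left
    rw [lintegral_map hv hpts,
      lintegral_prod (fun q : (ℕ → ℝ) × (ℕ → E) => F (t, v) (fun l => (arrival q.1 l, q.2 l)))
        (hv.comp hpts).aemeasurable]

/-! ### The exponential on the extended half-line. -/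

/-- The function `a ↦ exp (-a)` on `[0, ∞]`. -/
noncomputable def expNeg (a : ℝ≥0∞) : ℝ≥0∞ := EReal.exp (-(a : EReal))

lemma expNeg_of_ne_top {a : ℝ≥0∞} (ha : a ≠ ∞) :
    expNeg a = ENNReal.ofReal (Real.exp (-a.toReal)) := by
  lift a to NNReal using ha
  rw [expNeg, ← EReal.exp_coe]
  rfl

@[simp] lemma expNeg_top : expNeg ∞ = 0 := by simp [expNeg]

lemma expNeg_add (a b : ℝ≥0∞) : expNeg (a + b) = expNeg a * expNeg b := by
  rcases eq_or_ne a ∞ with rfl | ha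
  · simp
  rcases eq_or_ne b ∞ with rfl | hb
  · simp
  rw [expNeg_of_ne_top ha, expNeg_of_ne_top hb, expNeg_of_ne_top (ENNReal.add_ne_top.2 ⟨ha, hb⟩),
    ← ENNReal.ofReal_mul (Real.exp_pos _).le, ← Real.exp_add, ENNReal.toReal_add ha hb, neg_add]

lemma expNeg_antitone : Antitone expNeg := fun _ _ h =>
  EReal.exp_monotone (EReal.neg_le_neg_iff.2 (EReal.coe_ennreal_le_coe_ennreal_iff.2 h))

@[fun_prop]
lemma measurable_expNeg : Measurable expNeg := expNeg_antitone.measurable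

/-! ### Consequences of the Mecke equation: void probabilities, finiteness, no ties. -/

section IsMecke

variable {A : Type*}

/-- The number of points of the sequence `p` in `B`. -/
noncomputable def pointCount (B : Set A) (p : ℕ → A) : ℝ≥0∞ := ∑' j, B.indicator 1 (p j)

lemma pointCount_eq_encard (B : Set A) (p : ℕ → A) :
    pointCount B p = ({j | p j ∈ B}.encard : ℝ≥0∞) := by
  rw [← ENNReal.tsum_set_one, tsum_subtype {j | p j ∈ B} fun _ => (1 : ℝ≥0∞)]
  rfl

lemma pointCount_eq_zero_iff {B : Set A} {p : ℕ → A} : pointCount B p = 0 ↔ ∀ j, p j ∉ B := by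
  simp [pointCount]

variable [MeasurableSpace A] {Λ : Measure A} {M : Measure (ℕ → A)}

lemma measurable_pointCount {B : Set A} (hB : MeasurableSet B) : Measurable (pointCount B) :=
  .tsum fun j => (measurable_one.indicator hB).comp (measurable_pi_apply j)

/-- Campbell's formula: the Mecke equation for a function that ignores the configuration. -/
lemma IsMecke.lintegral_tsum [IsProbabilityMeasure M] (h : IsMecke Λ M) {g : A → ℝ≥0∞}
    (hg : Measurable g) : ∫⁻ p, ∑' j, g (p j) ∂M = ∫⁻ a, g a ∂Λ := by
  simpa using h (fun a _ => g a) (hg.comp measurable_fst)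

lemma IsMecke.ae_forall [IsProbabilityMeasure M] (h : IsMecke Λ M) {B : Set A}
    (hB : MeasurableSet B) (h0 : Λ B = 0) : ∀ᵐ p ∂M, ∀ j, p j ∉ B := by
  have h1 := h.lintegral_tsum (measurable_one.indicator hB)
  rw [lintegral_indicator_one hB, h0] at h1
  filter_upwards [(lintegral_eq_zero_iff (measurable_pointCount hB)).1 h1] with p hp
  exact pointCount_eq_zero_iff.1 hp

lemma IsMecke.ae_finite [IsProbabilityMeasure M] (h : IsMecke Λ M) {B : Set A}
    (hB : MeasurableSet B) (hfin : Λ B ≠ ∞) : ∀ᵐ p ∂M, {j | p j ∈ B}.Finite := by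
  have h1 := h.lintegral_tsum (measurable_one.indicator hB)
  rw [lintegral_indicator_one hB] at h1
  filter_upwards [ae_lt_top (measurable_pointCount hB) (h1.trans_ne hfin)] with p hp
  rw [pointCount_eq_encard] at hp
  exact Set.encard_lt_top_iff.1 (by simpa using hp)

/-- Mecke's equation is applied to "`a` lies in `B` and the rest has `k` points in `B`". A
configuration with `k + 1` points in `B` satisfies this for exactly `k + 1` choices of the removed
point. -/
lemma IsMecke.pointCount_succ [IsProbabilityMeasure M] (h : IsMecke Λ M) {B : Set A}
    (hB : MeasurableSet B) (k : ℕ) :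
    (k + 1) * M {p | pointCount B p = (k + 1 : ℕ)} = Λ B * M {p | pointCount B p = k} := by
  have hS : ∀ k : ℕ, MeasurableSet {p | pointCount B p = k} := fun k =>
    measurable_pointCount hB (measurableSet_singleton _)
  have key := h (fun a p => B.indicator 1 a * {p | pointCount B p = k}.indicator 1 p)
    (((measurable_one.indicator hB).comp measurable_fst).mul
      ((measurable_one.indicator (hS k)).comp measurable_snd))
  have hR : ∫⁻ a, ∫⁻ p, B.indicator 1 a * {p | pointCount B p = k}.indicator 1 p ∂M ∂Λ =
      Λ B * M {p | pointCount B p = k} := by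
    simp_rw [lintegral_const_mul _ (measurable_one.indicator (hS k)),
      lintegral_indicator_one (hS k)]
    rw [lintegral_mul_const _ (measurable_one.indicator hB), lintegral_indicator_one hB]
  rw [← hR, ← key, ← lintegral_indicator_one (hS (k + 1)),
    ← lintegral_const_mul _ (measurable_one.indicator (hS (k + 1)))]
  refine lintegral_congr fun p => ?_
  have hj : ∀ j, B.indicator (1 : A → ℝ≥0∞) (p j) *
      {p | pointCount B p = k}.indicator 1 (fun l => p (skip j l)) =
      B.indicator (1 : A → ℝ≥0∞) (p j) * {p | pointCount B p = (k + 1 : ℕ)}.indicator 1 p := by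
    intro j
    by_cases hj : p j ∈ B
    · have : pointCount B p = 1 + pointCount B (fun l => p (skip j l)) := by
        rw [pointCount, tsum_eq_add_tsum_skip _ j, Set.indicator_of_mem hj]
        rfl
      have hiff : pointCount B p = (k + 1 : ℕ) ↔ pointCount B (fun l => p (skip j l)) = k := by
        rw [this, Nat.cast_add, add_comm (k : ℝ≥0∞), Nat.cast_one,
          ENNReal.add_right_inj ENNReal.one_ne_top]
      by_cases hk : pointCount B p = (k + 1 : ℕ)
      · rw [Set.indicator_of_mem (s := {p | pointCount B p = k}) (hiff.1 hk),
          Set.indicator_of_mem (s := {p | pointCount B p = (k + 1 : ℕ)}) hk]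
        rfl
      · rw [Set.indicator_of_notMem (s := {p | pointCount B p = k}) fun h => hk (hiff.2 h),
          Set.indicator_of_notMem (s := {p | pointCount B p = (k + 1 : ℕ)}) hk]
    · simp [hj]
  simp_rw [hj]
  rw [ENNReal.tsum_mul_right]
  by_cases hp : pointCount B p = (k + 1 : ℕ)
  · rw [← pointCount, hp]; push_cast; rfl
  · rw [Set.indicator_of_notMem (by exact hp), mul_zero, mul_zero]

/-- The recursion makes the count probabilities proportional to `r ^ k / k!`. The count is almost
surely finite, so they sum to `1`, which forces the probability of no point to be `exp (-r)`. -/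
lemma IsMecke.void_of_ne_top [IsProbabilityMeasure M] (h : IsMecke Λ M) {B : Set A}
    (hB : MeasurableSet B) (hfin : Λ B ≠ ∞) : M {p | ∀ j, p j ∉ B} = expNeg (Λ B) := by
  have hS : ∀ k : ℕ, MeasurableSet {p | pointCount B p = k} := fun k =>
    measurable_pointCount hB (measurableSet_singleton _)
  set r := (Λ B).toReal with hr
  have hr0 : 0 ≤ r := ENNReal.toReal_nonneg
  have hrec : ∀ k : ℕ, M {p | pointCount B p = k} =
      ENNReal.ofReal (r ^ k / k.factorial) * M {p | pointCount B p = 0} := by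
    intro k
    induction k with
    | zero => simp
    | succ k ih =>
      have h1 := h.pointCount_succ hB k
      have hk : (k + 1 : ℝ≥0∞) = ENNReal.ofReal (k + 1) := by
        rw [ENNReal.ofReal_add (by positivity) zero_le_one]; simp
      rw [ih, ← ENNReal.ofReal_toReal hfin, ← hr, ← mul_assoc, ← ENNReal.ofReal_mul hr0] at h1
      have h2 : r * (r ^ k / k.factorial) = (k + 1) * (r ^ (k + 1) / (k + 1).factorial) := by
        rw [Nat.factorial_succ]; push_cast; field_simp; ring
      rw [h2, ENNReal.ofReal_mul (by positivity), ← hk, mul_assoc] at h1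
      exact (ENNReal.mul_right_inj (by simp) (by simp [ENNReal.add_eq_top])).1 h1
  have hsum : ∑' k : ℕ, M {p | pointCount B p = k} = 1 := by
    rw [← measure_iUnion _ hS]
    · refine (prob_compl_eq_zero_iff (.iUnion hS)).1 ?_
      refine ae_iff.1 ?_
      filter_upwards [h.ae_finite hB hfin] with p hp
      refine Set.mem_iUnion.2 ⟨{j | p j ∈ B}.ncard, ?_⟩
      rw [Set.mem_ofPred_eq, pointCount_eq_encard, ← hp.cast_ncard_eq]
      rfl
    · intro k l hkl
      refine Set.disjoint_left.2 fun p hp hp' => hkl ?_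
      exact_mod_cast (hp : pointCount B p = k).symm.trans hp'
  simp_rw [hrec] at hsum
  rw [ENNReal.tsum_mul_right, ← ENNReal.ofReal_tsum_of_nonneg (fun k => by positivity)
    (Real.summable_pow_div_factorial r), (NormedSpace.expSeries_div_hasSum_exp r).tsum_eq,
    ← Real.exp_eq_exp_ℝ] at hsum
  have hset : {p : ℕ → A | ∀ j, p j ∉ B} = {p | pointCount B p = 0} := by
    ext p; exact pointCount_eq_zero_iff.symm
  rw [hset, expNeg_of_ne_top hfin, ← hr, Real.exp_neg, ENNReal.ofReal_inv_of_pos (Real.exp_pos _)]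
  exact (ENNReal.eq_inv_of_mul_eq_one_left (by rwa [mul_comm])) 

/-- The void probabilities of a Poisson process. -/
lemma IsMecke.void [IsProbabilityMeasure M] [SigmaFinite Λ] (h : IsMecke Λ M) {B : Set A}
    (hB : MeasurableSet B) : M {p | ∀ j, p j ∉ B} = expNeg (Λ B) := by
  by_cases hfin : Λ B = ∞
  swap; · exact h.void_of_ne_top hB hfin
  rw [hfin, expNeg_top]
  have hle : ∀ m, M {p | ∀ j, p j ∉ B} ≤ expNeg (Λ (B ∩ spanningSets Λ m)) := by
    intro m
    rw [← h.void_of_ne_top (hB.inter (measurableSet_spanningSets Λ m))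
      ((measure_mono Set.inter_subset_right).trans_lt (measure_spanningSets_lt_top Λ m)).ne]
    exact measure_mono fun p hp j hj => hp j hj.1
  have hlim : Filter.Tendsto (fun m => Λ (B ∩ spanningSets Λ m)) Filter.atTop (nhds ∞) := by
    have := tendsto_measure_iUnion_atTop (μ := Λ) (s := fun m => B ∩ spanningSets Λ m)
      (fun m n hmn => Set.inter_subset_inter_right _ (monotone_spanningSets Λ hmn))
    rwa [← Set.inter_iUnion, iUnion_spanningSets, Set.inter_univ, hfin] at this
  have hexp : Filter.Tendsto expNeg (nhds ∞) (nhds 0) := by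
    have : Continuous expNeg := by
      exact ENNReal.continuous_exp.comp (continuous_neg.comp continuous_coe_ennreal_ereal)
    simpa using this.tendsto ∞
  exact le_antisymm (ge_of_tendsto' (hexp.comp hlim) hle) zero_le

/-- Almost surely no two points have the same value under `g`, if `g` is diffuse under `Λ`. -/
lemma IsMecke.ae_no_ties [IsProbabilityMeasure M] (h : IsMecke Λ M) {g : A → ℝ}
    (hg : Measurable g) (h0 : ∀ c, 0 < c → Λ {a | g a = c} = 0) :
    ∀ᵐ p ∂M, ∀ j l, 0 < g (p j) → g (p j) = g (p l) → j = l := by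
  have hT : MeasurableSet {q : A × A | 0 < g q.1 ∧ g q.1 = g q.2} :=
    (measurableSet_lt measurable_const (hg.comp measurable_fst)).inter
      (measurableSet_eq_fun (hg.comp measurable_fst) (hg.comp measurable_snd))
  set T := {q : A × A | 0 < g q.1 ∧ g q.1 = g q.2} with hTdef
  -- The function counts the ties of `a` with the points of `p`. Its expectation vanishes for each
  -- fixed `a` by Campbell's formula, so Mecke's equation makes the expected number of tied pairs
  -- zero.
  have hF : Measurable (Function.uncurry fun (a : A) (p : ℕ → A) =>
      ∑' l, T.indicator (1 : A × A → ℝ≥0∞) (a, p l)) :=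
    .tsum fun l => (measurable_one.indicator hT).comp
      (measurable_fst.prodMk ((measurable_pi_apply l).comp measurable_snd))
  have h1 := h _ hF
  have h2 : ∫⁻ a, ∫⁻ p, ∑' l, T.indicator (1 : A × A → ℝ≥0∞) (a, p l) ∂M ∂Λ = 0 := by
    refine lintegral_eq_zero_of_ae_eq_zero (ae_of_all _ fun a => ?_)
    dsimp only
    rw [h.lintegral_tsum (g := fun b => T.indicator (1 : A × A → ℝ≥0∞) (a, b))
      ((measurable_one.indicator hT).comp measurable_prodMk_left)]
    have : (fun b => T.indicator (1 : A × A → ℝ≥0∞) (a, b)) =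
        (Prod.mk a ⁻¹' T).indicator 1 := rfl
    rw [this, lintegral_indicator_one (measurable_prodMk_left hT)]
    by_cases ha : 0 < g a
    · refine measure_mono_null ?_ (h0 _ ha)
      rintro b ⟨-, hb⟩
      exact hb.symm
    · have : Prod.mk a ⁻¹' T = ∅ := by
        ext b; simp [hTdef, ha]
      rw [this, measure_empty, Pi.zero_apply]
  rw [h2, lintegral_eq_zero_iff] at h1
  swap
  · exact .tsum fun j => hF.comp ((measurable_pi_apply j).prodMk (measurable_skip j))
  filter_upwards [h1] with p hp j l hj hjl
  by_contra hne
  obtain ⟨m, rfl⟩ := exists_skip_eq (Ne.symm hne)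
  simp only [Pi.zero_apply, ENNReal.tsum_eq_zero] at hp
  have := hp j m
  rw [Set.indicator_of_mem (show (p j, p (skip j m)) ∈ T from ⟨hj, hjl⟩)] at this
  simp at this

end IsMecke

/-! ### Collecting extremal functions above a given lower bound. -/

section hitMax

variable {K A : Type*}

/-- The sequences none of whose terms is in `U`. -/
def voidSet (U : Set A) : Set (ℕ → A) := {p | ∀ j, p j ∉ U}

/-- The values at every `y` of the functions `φ (p j)` are positive for finitely many `j` up to
arbitrarily small values, and the positive ones are distinct. -/
structure IsRegularSeq (φ : A → K → ℝ) (p : ℕ → A) : Prop where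
  finite : ∀ y c, 0 < c → {j | c < φ (p j) y}.Finite
  no_ties : ∀ y j l, 0 < φ (p j) y → φ (p j) y = φ (p l) y → j = l

lemma IsRegularSeq.bddAbove {φ : A → K → ℝ} {p : ℕ → A} (h : IsRegularSeq φ p) (y : K) :
    BddAbove (Set.range fun j => φ (p j) y) := by
  obtain ⟨C, hC⟩ := ((h.finite y 1 one_pos).image fun j => φ (p j) y).bddAbove
  refine ⟨max C 1, ?_⟩
  rintro _ ⟨j, rfl⟩
  by_cases hj : 1 < φ (p j) y
  · exact le_max_of_le_left (hC ⟨j, hj, rfl⟩)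
  · exact le_max_of_le_right (not_lt.1 hj)

/-- Only finitely many values exceed half of a given positive one, so the supremum is a maximum over
a finite set. -/
lemma IsRegularSeq.exists_max {φ : A → K → ℝ} {p : ℕ → A} (h : IsRegularSeq φ p) {y : K}
    {l : ℕ} (hl : 0 < φ (p l) y) : ∃ j, ∀ i, φ (p i) y ≤ φ (p j) y := by
  obtain ⟨j, hj, hmax⟩ := Set.exists_max_image _ (fun j => φ (p j) y)
    (h.finite y (φ (p l) y / 2) (by positivity)) ⟨l, by simpa using hl⟩
  refine ⟨j, fun i => ?_⟩
  by_cases hi : φ (p l) y / 2 < φ (p i) y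
  · exact hmax i hi
  · exact (not_lt.1 hi).trans hj.le

lemma IsRegularSeq.skip {φ : A → K → ℝ} {p : ℕ → A} (h : IsRegularSeq φ p) (j : ℕ) :
    IsRegularSeq φ fun l => p (skip j l) where
  finite y c hc := (h.finite y c hc).preimage (f := MaxStable.skip j) (skip_injective j).injOn
  no_ties y _ _ hi hil := skip_injective j (h.no_ties y _ _ hi hil)

/-- The function `φ (p j)` is maximal among the `φ (p l)`, positive and not smaller than `z`, at
some point of `I`. -/
def IsHit (φ : A → K → ℝ) (I : Finset K) (z : K → ℝ) (p : ℕ → A) (j : ℕ) : Prop :=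
  ∃ i ∈ I, 0 < φ (p j) i ∧ z i ≤ φ (p j) i ∧ ∀ l, φ (p l) i ≤ φ (p j) i

/-- The maximum of `z` and of the functions `φ (p j)` that satisfy `IsHit`. -/
noncomputable def hitMax (φ : A → K → ℝ) (I : Finset K) (z : K → ℝ) (p : ℕ → A) : K → ℝ :=
  fun y => z y ⊔ ⨆ j, {j | IsHit φ I z p j}.indicator (fun j => φ (p j) y) j

variable {φ : A → K → ℝ} {I : Finset K} {z : K → ℝ} {p : ℕ → A}

@[simp] lemma hitMax_empty (hz : ∀ y, 0 ≤ z y) : hitMax φ ∅ z p = z := by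
  ext y
  simp [hitMax, IsHit, hz y]

/-- The sign condition on `c` is needed because every index that is not hit contributes the value
`0` to the supremum. -/
lemma hitMax_le_iff (hp : IsRegularSeq φ p) {y : K} {c : ℝ} (hc : 0 ≤ c) :
    hitMax φ I z p y ≤ c ↔ z y ≤ c ∧ ∀ j, IsHit φ I z p j → φ (p j) y ≤ c := by
  rw [hitMax, sup_le_iff]
  refine and_congr_right fun _ => ⟨fun h j hj => ?_, fun h => Real.iSup_le (fun j => ?_) hc⟩
  · have hb : BddAbove (Set.range fun j =>
        {j | IsHit φ I z p j}.indicator (fun j => φ (p j) y) j) := by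
      obtain ⟨C, hC⟩ := hp.bddAbove y
      refine ⟨max C 0, ?_⟩
      rintro _ ⟨j, rfl⟩
      refine Set.indicator_apply_le' (fun _ => le_max_of_le_left (hC ⟨j, rfl⟩))
        fun _ => le_max_right _ _
    have := (le_ciSup hb j).trans h
    rwa [Set.indicator_of_mem (by exact hj)] at this
  · exact Set.indicator_apply_le' (fun hj => h j hj) fun _ => hc

lemma le_hitMax (y : K) : z y ≤ hitMax φ I z p y := le_sup_left

lemma hitMax_eq_of_forall_le {x : K} (hz : 0 ≤ z x)
    (h : ∀ l, 0 < φ (p l) x → φ (p l) x ≤ z x) : hitMax φ I z p x = z x := by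
  refine sup_eq_left.2 (Real.iSup_le (fun j => ?_) hz)
  refine Set.indicator_apply_le' (fun _ => ?_) fun _ => hz
  exact (le_or_gt (φ (p j) x) 0).elim (fun h => h.trans hz) (h j)

variable [DecidableEq K] {x : K}

lemma hitMax_insert_of_forall_not (h : ∀ l, ¬ (0 < φ (p l) x ∧ z x ≤ φ (p l) x)) :
    hitMax φ (insert x I) z p = hitMax φ I z p := by
  have : ∀ j, IsHit φ (insert x I) z p j ↔ IsHit φ I z p j := fun j => by
    simp only [IsHit, Finset.mem_insert, exists_eq_or_imp]
    exact or_iff_right fun hx => h j ⟨hx.1, hx.2.1⟩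
  unfold hitMax
  simp only [this]

/-- The strict maximizer `p j` at `x` can be moved out of the sequence and into the lower bound. For
another point, the comparison with `φ (p j)` passes from the maximality clause of `IsHit` to its
threshold clause. -/
lemma hitMax_insert_of_isMax (hp : IsRegularSeq φ p) (hz : ∀ y, 0 ≤ z y) {j : ℕ}
    (hpos : 0 < φ (p j) x) (hzj : z x ≤ φ (p j) x)
    (hmax : ∀ l, φ (p (skip j l)) x < φ (p j) x) :
    hitMax φ (insert x I) z p = hitMax φ I (z ⊔ φ (p j)) (fun l => p (skip j l)) := by
  have hj : IsHit φ (insert x I) z p j := by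
    refine ⟨x, Finset.mem_insert_self _ _, hpos, hzj, (forall_iff_skip j).2 ⟨le_rfl, ?_⟩⟩
    exact fun l => (hmax l).le
  have hskip : ∀ m, IsHit φ (insert x I) z p (skip j m) ↔
      IsHit φ I (z ⊔ φ (p j)) (fun l => p (skip j l)) m := by
    intro m
    simp only [IsHit, Finset.mem_insert, exists_eq_or_imp, Pi.sup_apply, sup_le_iff]
    rw [or_iff_right fun hx => (hmax m).not_ge (hx.2.2 j)]
    refine exists_congr fun i => and_congr_right fun _ => and_congr_right fun _ => ?_
    rw [forall_iff_skip j, and_assoc]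
  ext y
  have hn1 : 0 ≤ hitMax φ (insert x I) z p y := (hz y).trans (le_hitMax y)
  have hn2 : 0 ≤ hitMax φ I (z ⊔ φ (p j)) (fun l => p (skip j l)) y :=
    ((hz y).trans (le_sup_left (b := φ (p j) y))).trans (le_hitMax (z := z ⊔ φ (p j)) y)
  have hiff : ∀ c, 0 ≤ c → (hitMax φ (insert x I) z p y ≤ c ↔
      hitMax φ I (z ⊔ φ (p j)) (fun l => p (skip j l)) y ≤ c) := by
    intro c hc
    rw [hitMax_le_iff hp hc, hitMax_le_iff (hp.skip j) hc, forall_iff_skip j]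
    simp only [hskip, hj, true_imp_iff, Pi.sup_apply, sup_le_iff, and_assoc]
  exact le_antisymm ((hiff _ hn2).2 le_rfl) ((hiff _ hn1).1 le_rfl)

end hitMax

/-! ### Conditional law of the points given the extremal functions. -/

section Resampling

variable {K A : Type*} [MeasurableSpace A] {φ : A → K → ℝ}

lemma measurableSet_voidSet {U : Set A} (hU : MeasurableSet U) : MeasurableSet (voidSet U) := by
  have : voidSet U = ⋂ j, (fun p : ℕ → A => p j) ⁻¹' Uᶜ := by ext; simp [voidSet]
  rw [this]
  exact .iInter fun j => measurable_pi_apply j hU.compl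

lemma measurable_hitMax (hφ : Measurable φ) (I : Finset K) :
    Measurable fun q : (K → ℝ) × (ℕ → A) => hitMax φ I q.1 q.2 := by
  have hφj : ∀ j y, Measurable fun q : (K → ℝ) × (ℕ → A) => φ (q.2 j) y := fun j y =>
    (measurable_pi_apply y).comp (hφ.comp ((measurable_pi_apply j).comp measurable_snd))
  have hz : ∀ y, Measurable fun q : (K → ℝ) × (ℕ → A) => q.1 y := fun y =>
    (measurable_pi_apply y).comp measurable_fst
  have hS : ∀ j, MeasurableSet {q : (K → ℝ) × (ℕ → A) | IsHit φ I q.1 q.2 j} := by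
    intro j
    have : {q : (K → ℝ) × (ℕ → A) | IsHit φ I q.1 q.2 j} = ⋃ i ∈ I,
        ({q | 0 < φ (q.2 j) i} ∩ ({q | q.1 i ≤ φ (q.2 j) i} ∩
          ⋂ l, {q | φ (q.2 l) i ≤ φ (q.2 j) i})) := by
      ext q; simp only [IsHit, Set.mem_iUnion, Set.mem_inter_iff, Set.mem_iInter, exists_prop]; rfl
    rw [this]
    refine Finset.measurableSet_biUnion _ fun i _ => ?_
    exact (measurableSet_lt measurable_const (hφj j i)).inter
      ((measurableSet_le (hz i) (hφj j i)).inter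
        (.iInter fun l => measurableSet_le (hφj l i) (hφj j i)))
  refine measurable_pi_lambda _ fun y => (hz y).sup (.iSup fun j => ?_)
  exact (hφj j y).indicator (hS j)

variable {Λ : Measure A} {M : Measure (ℕ → A)}

/-- Decomposition with respect to the function that is maximal at `x`. -/
lemma IsMecke.lintegral_hitMax_insert [DecidableEq K] [SFinite Λ] (h : IsMecke Λ M)
    (hφ : Measurable φ) (hreg : ∀ᵐ p ∂M, IsRegularSeq φ p) {x : K} {I : Finset K} {U : Set A}
    (hU : MeasurableSet U) {z : K → ℝ} (hz : ∀ y, 0 ≤ z y) {G : (K → ℝ) → (ℕ → A) → ℝ≥0∞}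
    (hG : Measurable (Function.uncurry G))
    (hskip : ∀ w p j, φ (p j) x = w x → G w p = G w fun l => p (skip j l)) :
    ∫⁻ p, (voidSet U).indicator 1 p * G (hitMax φ (insert x I) z p) p ∂M =
      ∫⁻ p, (voidSet (U ∪ {a | 0 < φ a x ∧ z x ≤ φ a x})).indicator 1 p *
        G (hitMax φ I z p) p ∂M +
      ∫⁻ a, {a | a ∉ U ∧ 0 < φ a x ∧ z x ≤ φ a x}.indicator 1 a *
        ∫⁻ p, (voidSet (U ∪ {b | φ a x ≤ φ b x})).indicator 1 p *
          G (hitMax φ I (z ⊔ φ a) p) p ∂M ∂Λ := by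
  have hφx : Measurable fun a => φ a x := (measurable_pi_apply x).comp hφ
  have hP : MeasurableSet {a | 0 < φ a x ∧ z x ≤ φ a x} :=
    (measurableSet_lt measurable_const hφx).inter (measurableSet_le measurable_const hφx)
  have hC : MeasurableSet {a | a ∉ U ∧ 0 < φ a x ∧ z x ≤ φ a x} := hU.compl.inter hP
  have hV : MeasurableSet {q : A × (ℕ → A) | q.2 ∈ voidSet (U ∪ {b | φ q.1 x ≤ φ b x})} := by
    have : {q : A × (ℕ → A) | q.2 ∈ voidSet (U ∪ {b | φ q.1 x ≤ φ b x})} =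
        ⋂ j, ((fun q => q.2 j) ⁻¹' U ∪ {q | φ q.1 x ≤ φ (q.2 j) x})ᶜ := by
      ext q; simp [voidSet]
    rw [this]
    refine .iInter fun j => .compl (.union ?_ ?_)
    · exact ((measurable_pi_apply j).comp measurable_snd) hU
    · exact measurableSet_le (hφx.comp measurable_fst)
        (hφx.comp ((measurable_pi_apply j).comp measurable_snd))
  have hF0 : Measurable fun q : A × (ℕ → A) =>
      {q : A × (ℕ → A) | q.2 ∈ voidSet (U ∪ {b | φ q.1 x ≤ φ b x})}.indicator 1 q *
        G (hitMax φ I (z ⊔ φ q.1) q.2) q.2 := by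
    refine (measurable_one.indicator hV).mul (hG.comp (Measurable.prodMk ?_ measurable_snd))
    refine (measurable_hitMax hφ I).comp (Measurable.prodMk ?_ measurable_snd)
    exact measurable_pi_lambda _ fun y => measurable_const.sup
      ((measurable_pi_apply y).comp (hφ.comp measurable_fst))
  -- The term of the point `a`, with the rest `p`: the void condition on `{b | φ a x ≤ φ b x}` says
  -- that `a` is the strict maximizer at `x`.
  set F : A → (ℕ → A) → ℝ≥0∞ := fun a p =>
    {a | a ∉ U ∧ 0 < φ a x ∧ z x ≤ φ a x}.indicator 1 a *
      ((voidSet (U ∪ {b | φ a x ≤ φ b x})).indicator 1 p * G (hitMax φ I (z ⊔ φ a) p) p) with hFdef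
  have hF : Measurable (Function.uncurry F) :=
    ((measurable_one.indicator hC).comp measurable_fst).mul hF0
  have hA : Measurable fun p : ℕ → A =>
      (voidSet (U ∪ {a | 0 < φ a x ∧ z x ≤ φ a x})).indicator 1 p * G (hitMax φ I z p) p := by
    refine (measurable_one.indicator (measurableSet_voidSet (hU.union hP))).mul ?_
    exact hG.comp (((measurable_hitMax hφ I).comp measurable_prodMk_left).prodMk measurable_id)
  trans ∫⁻ p, ((voidSet (U ∪ {a | 0 < φ a x ∧ z x ≤ φ a x})).indicator 1 p *
      G (hitMax φ I z p) p + ∑' j, F (p j) (fun l => p (skip j l))) ∂M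
  · refine lintegral_congr_ae ?_
    filter_upwards [hreg] with p hp
    by_cases hpU : p ∈ voidSet U
    swap
    · obtain ⟨l, hl⟩ : ∃ l, p l ∈ U := by simpa [voidSet] using hpU
      have hpU' : p ∉ voidSet (U ∪ {a | 0 < φ a x ∧ z x ≤ φ a x}) := fun h => h l (Or.inl hl)
      rw [Set.indicator_of_notMem hpU, Set.indicator_of_notMem hpU', zero_mul,
        zero_mul, zero_add, eq_comm, ENNReal.tsum_eq_zero]
      intro j
      rcases eq_or_ne l j with rfl | hne
      · rw [hFdef]; dsimp only
        rw [Set.indicator_of_notMem fun h => h.1 hl, zero_mul]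
      · obtain ⟨m, rfl⟩ := exists_skip_eq hne
        have hv : (fun l => p (skip j l)) ∉ voidSet (U ∪ {b | φ (p j) x ≤ φ b x}) :=
          fun h => h m (Or.inl hl)
        rw [hFdef]; dsimp only
        rw [Set.indicator_of_notMem hv, zero_mul, mul_zero]
    by_cases hnone : ∀ l, ¬ (0 < φ (p l) x ∧ z x ≤ φ (p l) x)
    · have h0 : ∀ j, F (p j) (fun l => p (skip j l)) = 0 := fun j => by
        rw [hFdef]; dsimp only
        rw [Set.indicator_of_notMem fun h => hnone j h.2, zero_mul]
      rw [ENNReal.tsum_eq_zero.2 h0, add_zero, Set.indicator_of_mem hpU, Set.indicator_of_mem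
        (show p ∈ voidSet _ from fun l hl => hl.elim (hpU l) (hnone l)),
        hitMax_insert_of_forall_not hnone]
    · push Not at hnone
      obtain ⟨l, hl0, hlz⟩ := hnone
      obtain ⟨j, hj⟩ := hp.exists_max hl0
      have hj0 : 0 < φ (p j) x := hl0.trans_le (hj l)
      have hjz : z x ≤ φ (p j) x := hlz.trans (hj l)
      have hlt : ∀ m, φ (p (skip j m)) x < φ (p j) x := fun m =>
        (hj _).lt_of_ne fun h => skip_ne j m (hp.no_ties x _ _ hj0 h.symm).symm
      -- The removed point realizes the final maximum at `x`, which is the condition of `hskip` for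
      -- deleting it from the second argument of `G`.
      have hval : hitMax φ I (z ⊔ φ (p j)) (fun l => p (skip j l)) x = φ (p j) x := by
        have hsup : (z ⊔ φ (p j)) x = φ (p j) x := sup_eq_right.2 hjz
        rw [hitMax_eq_of_forall_le] <;> rw [hsup]
        · exact hj0.le
        · exact fun m _ => (hlt m).le
      have hpA : p ∉ voidSet (U ∪ {a | 0 < φ a x ∧ z x ≤ φ a x}) := fun h =>
        h l (Or.inr ⟨hl0, hlz⟩)
      rw [tsum_eq_single j, Set.indicator_of_mem hpU,
        Set.indicator_of_notMem hpA, zero_mul, zero_add, hFdef]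
      · dsimp only
        rw [Set.indicator_of_mem (by exact ⟨hpU j, hj0, hjz⟩), Set.indicator_of_mem (by
          rintro m (hm | hm)
          · exact hpU _ hm
          · exact (hlt m).not_ge hm),
          hitMax_insert_of_isMax hp hz hj0 hjz hlt, hskip _ p j hval.symm]
        simp
      · intro i hi
        obtain ⟨m, hm⟩ := exists_skip_eq (Ne.symm hi)
        have hv : (fun l => p (skip i l)) ∉ voidSet (U ∪ {b | φ (p i) x ≤ φ b x}) :=
          fun h => h m (Or.inr (by dsimp only; rw [hm]; exact hj i))
        rw [hFdef]; dsimp only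
        rw [Set.indicator_of_notMem hv, zero_mul, mul_zero]
  · rw [lintegral_add_left hA, h F hF]
    congr 1
    refine lintegral_congr fun a => lintegral_const_mul _ ?_
    exact hF0.comp measurable_prodMk_left

/-- Conditionally on the functions which attain the maximum at some point of `I`, the other points
form a Poisson process. -/
theorem IsMecke.lintegral_voidSet_hitMax [IsProbabilityMeasure M] [SigmaFinite Λ] (h : IsMecke Λ M)
    (hφ : Measurable φ) (hreg : ∀ᵐ p ∂M, IsRegularSeq φ p) {B : Set ((K → ℝ) × A)}
    (hB : MeasurableSet B) (I : Finset K) (hBI : ∀ i ∈ I, ∀ z a, (z, a) ∈ B → φ a i < z i)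
    {U : Set A} (hU : MeasurableSet U) {z : K → ℝ} (hz : ∀ y, 0 ≤ z y) :
    ∫⁻ p, (voidSet U).indicator 1 p *
        (voidSet (Prod.mk (hitMax φ I z p) ⁻¹' B)).indicator 1 p ∂M =
      ∫⁻ p, (voidSet U).indicator 1 p *
        expNeg (Λ (Prod.mk (hitMax φ I z p) ⁻¹' B \ U)) ∂M := by
  classical
  -- Both sides obey the same decomposition at the inserted point; its two terms are instances of
  -- the claim for `I` with enlarged `U`, and in the second also with enlarged `z`.
  induction I using Finset.induction_on generalizing U z with
  | empty =>
    simp only [hitMax_empty hz]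
    have hBz : MeasurableSet (Prod.mk z ⁻¹' B) := measurable_prodMk_left hB
    rw [lintegral_mul_const _ (measurable_one.indicator (measurableSet_voidSet hU)),
      lintegral_indicator_one (measurableSet_voidSet hU)]
    have : (fun p => (voidSet U).indicator (1 : (ℕ → A) → ℝ≥0∞) p *
        (voidSet (Prod.mk z ⁻¹' B)).indicator 1 p) =
        -- With no extremal function left to collect, `z` is deterministic; the void probability of
        -- a disjoint union factorizes.
        (voidSet (U ∪ Prod.mk z ⁻¹' B \ U)).indicator 1 := by
      rw [Set.union_sdiff_self]
      have : voidSet (U ∪ Prod.mk z ⁻¹' B) = voidSet U ∩ voidSet (Prod.mk z ⁻¹' B) := by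
        ext p
        simp only [voidSet, Set.mem_union, not_or, Set.mem_ofPred_eq, Set.mem_inter_iff, forall_and]
      rw [this, Set.inter_indicator_one]
      rfl
    rw [this, lintegral_indicator_one (measurableSet_voidSet (hU.union (hBz.diff hU))), voidSet,
      h.void (hU.union (hBz.diff hU)), measure_union Set.disjoint_sdiff_right (hBz.diff hU),
      expNeg_add, ← h.void hU]
    rfl
  | insert x I _ ih =>
    have hφx : Measurable fun a => φ a x := (measurable_pi_apply x).comp hφ
    have hBI' : ∀ i ∈ I, ∀ z a, (z, a) ∈ B → φ a i < z i := fun i hi =>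
      hBI i (Finset.mem_insert_of_mem hi)
    have hBx : ∀ z a, (z, a) ∈ B → φ a x < z x := hBI x (Finset.mem_insert_self _ _)
    have hG1 : Measurable (Function.uncurry fun (w : K → ℝ) (p : ℕ → A) =>
        (voidSet (Prod.mk w ⁻¹' B)).indicator (1 : (ℕ → A) → ℝ≥0∞) p) := by
      have hS : MeasurableSet {q : (K → ℝ) × (ℕ → A) | ∀ j, (q.1, q.2 j) ∉ B} := by
        have : {q : (K → ℝ) × (ℕ → A) | ∀ j, (q.1, q.2 j) ∉ B} =
            ⋂ j, (fun q : (K → ℝ) × (ℕ → A) => (q.1, q.2 j)) ⁻¹' Bᶜ := by ext; simp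
        rw [this]
        refine .iInter fun j => Measurable.prodMk measurable_fst ?_ hB.compl
        exact (measurable_pi_apply j).comp measurable_snd
      exact measurable_one.indicator hS
    have hG2 : Measurable (Function.uncurry fun (w : K → ℝ) (_ : ℕ → A) =>
        expNeg (Λ (Prod.mk w ⁻¹' B \ U))) := by
      refine measurable_expNeg.comp
        (Measurable.comp (g := fun w => Λ (Prod.mk w ⁻¹' B \ U)) ?_ measurable_fst)
      have : MeasurableSet (B \ (Prod.snd ⁻¹' U)) := hB.diff (measurable_snd hU)
      exact measurable_measure_prodMk_left this
    rw [h.lintegral_hitMax_insert hφ hreg hU hz hG1, h.lintegral_hitMax_insert hφ hreg hU hz hG2]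
    · congr 1
      · have hP : MeasurableSet {a | 0 < φ a x ∧ z x ≤ φ a x} :=
          (measurableSet_lt measurable_const hφx).inter (measurableSet_le measurable_const hφx)
        rw [ih hBI' (hU.union hP) hz]
        refine lintegral_congr fun p => ?_
        by_cases hp : p ∈ voidSet (U ∪ {a | 0 < φ a x ∧ z x ≤ φ a x})
        swap; · rw [Set.indicator_of_notMem hp, zero_mul, zero_mul]
        congr 3
        -- No point reaches the positive threshold at `x`, so the final maximum there is still `z
        -- x`. Functions of the section of `B` are strictly below it and avoid the set just added to
        -- `U`.
        have hval : hitMax φ I z p x = z x := hitMax_eq_of_forall_le (hz x) fun l hl =>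
          le_of_not_ge fun hlz => hp l (Or.inr ⟨hl, hlz⟩)
        ext a
        simp only [Set.mem_sdiff, Set.mem_preimage, Set.mem_union, not_or]
        refine and_congr_right fun haB => and_iff_left ?_
        have := hBx _ _ haB
        rw [hval] at this
        exact fun ha => this.not_ge ha.2
      · refine lintegral_congr fun a => ?_
        by_cases ha : a ∈ {a | a ∉ U ∧ 0 < φ a x ∧ z x ≤ φ a x}
        swap; · rw [Set.indicator_of_notMem ha, zero_mul, zero_mul]
        congr 1
        have hP : MeasurableSet {b | φ a x ≤ φ b x} := measurableSet_le measurable_const hφx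
        have hz' : ∀ y, 0 ≤ (z ⊔ φ a) y := fun y => (hz y).trans le_sup_left
        rw [ih hBI' (hU.union hP) hz']
        refine lintegral_congr fun p => ?_
        by_cases hp : p ∈ voidSet (U ∪ {b | φ a x ≤ φ b x})
        swap; · rw [Set.indicator_of_notMem hp, zero_mul, zero_mul]
        congr 3
        have hval : hitMax φ I (z ⊔ φ a) p x = φ a x := by
          have hsup : (z ⊔ φ a) x = φ a x := sup_eq_right.2 ha.2.2
          rw [hitMax_eq_of_forall_le] <;> rw [hsup]
          · exact ha.2.1.le
          · exact fun l _ => le_of_not_ge fun hl => hp l (Or.inr hl)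
        ext b
        simp only [Set.mem_sdiff, Set.mem_preimage, Set.mem_union, not_or]
        refine and_congr_right fun hbB => and_iff_left ?_
        have := hBx _ _ hbB
        rw [hval] at this
        exact fun hb => this.not_ge hb
    · exact fun _ _ _ _ => rfl
    · intro w p j hj
      -- A function equal to `w` at `x` is not in the section of `B`, whose members are strictly
      -- below `w` there, so deleting it does not affect the void event.
      have hnot : p j ∉ Prod.mk w ⁻¹' B := fun hB => (hBx _ _ hB).ne hj
      have : p ∈ voidSet (Prod.mk w ⁻¹' B) ↔ (fun l => p (skip j l)) ∈ voidSet (Prod.mk w ⁻¹' B) :=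
        (forall_iff_skip j).trans (and_iff_right hnot)
      by_cases hp : p ∈ voidSet (Prod.mk w ⁻¹' B)
      · rw [Set.indicator_of_mem hp, Set.indicator_of_mem (this.1 hp)]; rfl
      · rw [Set.indicator_of_notMem hp, Set.indicator_of_notMem fun h => hp (this.2 h)]

end Resampling

/-! ### Extremal functions and the exceedance event. -/

section Extremal

variable {K A : Type*} {φ : A → K → ℝ} {p : ℕ → A}

lemma IsRegularSeq.le_extremalIndex (hp : IsRegularSeq φ p) {y : K} (hy : ∃ l, 0 < φ (p l) y)
    (i : ℕ) : φ (p i) y ≤ φ (p (extremalIndex (fun j => φ (p j)) y)) y := by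
  obtain ⟨l, hl⟩ := hy
  have : (extremalIndex (fun j => φ (p j)) y) ∈ {j | ∀ i, φ (p i) y ≤ φ (p j) y} :=
    Nat.sInf_mem (hp.exists_max hl)
  exact this i

lemma IsRegularSeq.eq_extremalIndex (hp : IsRegularSeq φ p) {y : K} (hy : ∃ l, 0 < φ (p l) y)
    {j : ℕ} (hj : φ (p (extremalIndex (fun j => φ (p j)) y)) y ≤ φ (p j) y) :
    j = extremalIndex (fun j => φ (p j)) y := by
  obtain ⟨l, hl⟩ := hy
  refine hp.no_ties y _ _ (hl.trans_le ((hp.le_extremalIndex ⟨l, hl⟩ l).trans hj)) ?_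
  exact le_antisymm (hp.le_extremalIndex ⟨l, hl⟩ j) hj

lemma IsRegularSeq.isHit_extremalIndex (hp : IsRegularSeq φ p) {I : Finset K} {y : K} (hI : y ∈ I)
    (hy : ∃ l, 0 < φ (p l) y) : IsHit φ I 0 p (extremalIndex (fun j => φ (p j)) y) := by
  obtain ⟨l, hl⟩ := hy
  have hle := hp.le_extremalIndex ⟨l, hl⟩
  exact ⟨y, hI, hl.trans_le (hle l), (hl.trans_le (hle l)).le, hle⟩

lemma IsRegularSeq.le_hitMax_of_isHit (hp : IsRegularSeq φ p) {I : Finset K} {j : ℕ}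
    (hj : IsHit φ I 0 p j) (y : K) : φ (p j) y ≤ hitMax φ I 0 p y :=
  ((hitMax_le_iff hp (le_hitMax (z := 0) y)).1 le_rfl).2 j hj

/-- Since the maximum at each `x i` is positive and has no ties, the points hit with lower bound `0`
are precisely the extremal ones. -/
lemma IsRegularSeq.extremalMax_eq [DecidableEq K] (hp : IsRegularSeq φ p)
    (h0 : ∀ j y, 0 ≤ φ (p j) y) {n : ℕ} (hn : 1 ≤ n) (x : Fin n → K)
    (hx : ∀ i, ∃ l, 0 < φ (p l) (x i)) :
    extremalMax (fun j => φ (p j)) x = hitMax φ (Finset.univ.image x) 0 p := by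
  have : Nonempty (Fin n) := ⟨⟨0, hn⟩⟩
  ext y
  have hbdd : BddAbove (Set.range fun i => extremalFunction (fun j => φ (p j)) (x i) y) :=
    Set.Finite.bddAbove (Set.finite_range _)
  refine le_antisymm (ciSup_le fun i => ?_) ((hitMax_le_iff hp ?_).2 ⟨?_, fun j hj => ?_⟩)
  · exact hp.le_hitMax_of_isHit
      (hp.isHit_extremalIndex (Finset.mem_image_of_mem _ (Finset.mem_univ i)) (hx i)) y
  · exact Real.iSup_nonneg fun i => h0 _ _
  · exact Real.iSup_nonneg fun i => h0 _ _
  · obtain ⟨_, hiI, -, -, hle⟩ := hj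
    obtain ⟨i, -, rfl⟩ := Finset.mem_image.1 hiI
    rw [hp.eq_extremalIndex (hx i) (hle _)]
    exact le_ciSup hbdd i

/-- The pairs `(z, a)` such that the function of the point `a` is below `z` on `I` and exceeds `z` by
more than `f` somewhere. -/
def exceedanceSet (φ : A → K → ℝ) (I : Finset K) (f : (K → ℝ) × K → ℝ≥0∞) :
    Set ((K → ℝ) × A) :=
  {q | (∀ i ∈ I, φ q.2 i < q.1 i) ∧
    ∃ y, ENNReal.ofReal (q.1 y) + f (q.1, y) < ENNReal.ofReal (φ q.2 y)}

lemma IsRegularSeq.exists_lt_iff (hp : IsRegularSeq φ p) {I : Finset K}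
    (hI : ∀ i ∈ I, ∃ l, 0 < φ (p l) i) (h0 : ∀ j y, 0 ≤ φ (p j) y)
    (f : (K → ℝ) × K → ℝ≥0∞) :
    (∃ y, f (hitMax φ I 0 p, y) <
      ENNReal.ofReal |pointwiseMax (fun j => φ (p j)) y - hitMax φ I 0 p y|) ↔
      p ∉ voidSet (Prod.mk (hitMax φ I 0 p) ⁻¹' exceedanceSet φ I f) := by
  set z := hitMax φ I 0 p with hz
  have hz0 : ∀ y, 0 ≤ z y := fun y => le_hitMax (z := 0) y
  have hle : ∀ j y, φ (p j) y ≤ pointwiseMax (fun j => φ (p j)) y := fun j y =>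
    le_ciSup (f := fun j => φ (p j) y) (hp.bddAbove y) j
  have hZ0 : ∀ y, 0 ≤ pointwiseMax (fun j => φ (p j)) y := fun y => (h0 0 y).trans (hle 0 y)
  have hzZ : ∀ y, z y ≤ pointwiseMax (fun j => φ (p j)) y := fun y =>
    (hitMax_le_iff hp (hZ0 y)).2 ⟨hZ0 y, fun j _ => hle j y⟩
  have h1 : ∀ y, (f (z, y) < ENNReal.ofReal |pointwiseMax (fun j => φ (p j)) y - z y|) ↔
      ENNReal.ofReal (z y) + f (z, y) < ENNReal.ofReal (pointwiseMax (fun j => φ (p j)) y) := by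
    intro y
    rw [abs_of_nonneg (sub_nonneg.2 (hzZ y)), ENNReal.ofReal_sub _ (hz0 y), lt_tsub_iff_left]
  simp only [h1]
  have hnot : p ∉ voidSet (Prod.mk z ⁻¹' exceedanceSet φ I f) ↔
      ∃ j, (z, p j) ∈ exceedanceSet φ I f := by
    simp [voidSet]
  rw [hnot]
  constructor
  · rintro ⟨y, hy⟩
    obtain ⟨j, hj⟩ : ∃ j, ENNReal.ofReal (z y) + f (z, y) < ENNReal.ofReal (φ (p j) y) := by
      by_contra! hcon
      have hfin : ENNReal.ofReal (z y) + f (z, y) ≠ ∞ := hy.ne_top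
      refine hy.not_ge ((ENNReal.ofReal_le_iff_le_toReal hfin).2 (ciSup_le fun j => ?_))
      exact (ENNReal.ofReal_le_iff_le_toReal hfin).1 (hcon j)
    refine ⟨j, fun i hi => ?_, y, hj⟩
    -- A function reaching `z` at a point of `I` would be the extremal function there, hence below
    -- `z` everywhere, contradicting the exceedance at `y`.
    by_contra! hge
    have hmax : φ (p (extremalIndex (fun j => φ (p j)) i)) i ≤ φ (p j) i :=
      (hp.le_hitMax_of_isHit (hp.isHit_extremalIndex hi (hI i hi)) i).trans hge
    have hhit : IsHit φ I 0 p j := by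
      rw [hp.eq_extremalIndex (hI i hi) hmax]
      exact hp.isHit_extremalIndex hi (hI i hi)
    exact hj.not_ge ((ENNReal.ofReal_le_ofReal (hp.le_hitMax_of_isHit hhit y)).trans le_self_add)
  · rintro ⟨j, -, y, hy⟩
    exact ⟨y, hy.trans_le (ENNReal.ofReal_le_ofReal (hle j y))⟩

lemma measurableSet_exceedanceSet [Countable K] [MeasurableSpace K] [MeasurableSpace A]
    (hφ : Measurable φ) (I : Finset K) {f : (K → ℝ) × K → ℝ≥0∞} (hf : Measurable f) :
    MeasurableSet (exceedanceSet φ I f) := by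
  have hφy : ∀ y, Measurable fun q : (K → ℝ) × A => φ q.2 y := fun y =>
    (measurable_pi_apply y).comp (hφ.comp measurable_snd)
  have hz : ∀ y, Measurable fun q : (K → ℝ) × A => q.1 y := fun y =>
    (measurable_pi_apply y).comp measurable_fst
  have : exceedanceSet φ I f = (⋂ i ∈ I, {q : (K → ℝ) × A | φ q.2 i < q.1 i}) ∩
      ⋃ y, {q | ENNReal.ofReal (q.1 y) + f (q.1, y) < ENNReal.ofReal (φ q.2 y)} := by
    ext q; simp [exceedanceSet]
  rw [this]
  refine (Finset.measurableSet_biInter _ fun i _ => measurableSet_lt (hφy i) (hz i)).inter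
    (.iUnion fun y => measurableSet_lt ?_ (hφy y).ennreal_ofReal)
  exact (hz y).ennreal_ofReal.add (hf.comp (measurable_fst.prodMk measurable_const))

end Extremal

/-! ### The intensity measure and the measure of the exceedance set. -/

section Intensity

variable {K : Type*}

/-- The function `w / t`. -/
noncomputable def scaled (a : ℝ × (K → ℝ)) (y : K) : ℝ := a.1⁻¹ * a.2 y

lemma measurable_scaled : Measurable (scaled (K := K)) :=
  measurable_pi_lambda _ fun y =>
    measurable_fst.inv.mul ((measurable_pi_apply y).comp measurable_snd)

lemma measurable_scaled_apply (y : K) : Measurable fun a : ℝ × (K → ℝ) => scaled a y :=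
  (measurable_pi_apply y).comp measurable_scaled

/-- The intensity of the Poisson process of the pairs `(Γ_j, W_j)`. -/
noncomputable def intensity (κ : Measure (K → ℝ)) : Measure (ℝ × (K → ℝ)) :=
  ((volume : Measure ℝ).restrict (Set.Ioi 0)).prod κ

variable {κ : Measure (K → ℝ)} [IsProbabilityMeasure κ]

instance : SigmaFinite (intensity κ) := by unfold intensity; infer_instance

lemma intensity_apply {S : Set (ℝ × (K → ℝ))} (hS : MeasurableSet S) :
    intensity κ S = ∫⁻ w, volume {t : ℝ | (t, w) ∈ S ∧ 0 < t} ∂κ := by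
  rw [intensity, Measure.prod_apply_symm hS]
  refine lintegral_congr fun w => ?_
  rw [Measure.restrict_apply (measurable_prodMk_right hS)]
  rfl

/-- For each `w` the admissible `t` have total length at most `w y / c` when `w y ≥ 0` and `0`
otherwise; the unit mean bounds the total by `1 / c`. -/
lemma intensity_lt_scaled_ne_top {y : K} (hκ : ∫⁻ w, ENNReal.ofReal (w y) ∂κ = 1) {c : ℝ}
    (hc : 0 < c) : intensity κ {a | c < scaled a y} ≠ ∞ := by
  rw [intensity_apply (measurableSet_lt measurable_const (measurable_scaled_apply y))]
  refine ne_top_of_le_ne_top (b := ENNReal.ofReal c⁻¹ * 1) (by simp) ?_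
  rw [← hκ, ← lintegral_const_mul' _ _ ENNReal.ofReal_ne_top]
  refine lintegral_mono fun w => ?_
  have : {t : ℝ | (t, w) ∈ {a : ℝ × (K → ℝ) | c < scaled a y} ∧ 0 < t} ⊆
      Set.Ioc 0 (c⁻¹ * w y) := by
    rintro t ⟨ht, ht0⟩
    refine ⟨ht0, ?_⟩
    have ht : c < t⁻¹ * w y := ht
    rw [inv_mul_eq_div, lt_div_iff₀ ht0] at ht
    rw [inv_mul_eq_div, le_div_iff₀ hc, mul_comm]
    exact ht.le
  refine (measure_mono this).trans ?_
  rw [Real.volume_Ioc, sub_zero, ENNReal.ofReal_mul (by positivity)]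

lemma intensity_scaled_eq (y : K) {c : ℝ} (hc : 0 < c) :
    intensity κ {a | scaled a y = c} = 0 := by
  rw [intensity_apply (measurableSet_eq_fun (measurable_scaled_apply y) measurable_const)]
  refine lintegral_eq_zero_of_ae_eq_zero (ae_of_all _ fun w => ?_)
  have : {t : ℝ | (t, w) ∈ {a : ℝ × (K → ℝ) | scaled a y = c} ∧ 0 < t} ⊆ {w y / c} := by
    rintro t ⟨ht, ht0⟩
    have ht : t⁻¹ * w y = c := ht
    rw [Set.mem_singleton_iff, ← ht]
    have : w y ≠ 0 := by rintro h; rw [h, mul_zero] at ht; exact hc.ne ht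
    field_simp
  exact measure_mono_null this (by simp)

/-- The unit mean forces `w y > 0` with positive probability, and then every `t > 0` is admissible.
-/
lemma intensity_scaled_pos {y : K} (hκ : ∫⁻ w, ENNReal.ofReal (w y) ∂κ = 1) :
    intensity κ {a | 0 < scaled a y} = ∞ := by
  rw [intensity_apply (measurableSet_lt measurable_const (measurable_scaled_apply y))]
  have hS : MeasurableSet {w : K → ℝ | 0 < w y} :=
    measurableSet_lt measurable_const (measurable_pi_apply y)
  rw [eq_top_iff]
  calc ∞ = ∞ * κ {w | 0 < w y} := by
        rw [ENNReal.top_mul]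
        intro h
        have : ∫⁻ w, ENNReal.ofReal (w y) ∂κ = 0 := by
          refine lintegral_eq_zero_of_ae_eq_zero ?_
          have h' : ∀ᵐ w ∂κ, ¬ 0 < w y := by simpa [ae_iff] using h
          filter_upwards [h'] with w hw
          simpa using hw
        rw [hκ] at this
        exact one_ne_zero this
    _ = ∫⁻ w, {w : K → ℝ | 0 < w y}.indicator (fun _ => ∞) w ∂κ := by
        rw [lintegral_indicator_const hS]
    _ ≤ _ := by
        refine lintegral_mono fun w => ?_
        refine Set.indicator_apply_le' (fun hw => ?_) fun _ => zero_le
        rw [← Real.volume_Ioi (a := 0)]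
        refine measure_mono fun t ht => ⟨?_, ht⟩
        have ht : 0 < t := ht
        exact mul_pos (inv_pos.2 ht) hw

lemma intensity_scaled_neg [Countable K] (hκ : ∀ᵐ w ∂κ, ∀ y, 0 ≤ w y) :
    intensity κ {a | ∃ y, scaled a y < 0} = 0 := by
  have hS : MeasurableSet {a : ℝ × (K → ℝ) | ∃ y, scaled a y < 0} := by
    simp only [Set.ofPred_exists]
    exact .iUnion fun y => measurableSet_lt (measurable_scaled_apply y) measurable_const
  rw [intensity_apply hS]
  refine lintegral_eq_zero_of_ae_eq_zero ?_
  filter_upwards [hκ] with w hw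
  have : {t : ℝ | (t, w) ∈ {a : ℝ × (K → ℝ) | ∃ y, scaled a y < 0} ∧ 0 < t} = ∅ := by
    refine Set.eq_empty_of_forall_notMem fun t ht => ?_
    obtain ⟨⟨y, hy⟩, ht0⟩ := ht
    exact hy.not_ge (mul_nonneg (inv_pos.2 ht0).le (hw y))
  exact (congrArg volume this).trans measure_empty

lemma volume_ofReal_between {m s : ℝ≥0∞} (hm : m ≠ ∞) :
    volume {t : ℝ | (m < ENNReal.ofReal t ∧ ENNReal.ofReal t < s) ∧ 0 < t} = s - m := by
  rcases eq_or_ne s ∞ with rfl | hs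
  · rw [ENNReal.top_sub hm]
    refine (congrArg volume ?_).trans (Real.volume_Ioi (a := m.toReal))
    ext t
    simp only [ENNReal.ofReal_lt_top, and_true, Set.mem_ofPred_eq, Set.mem_Ioi]
    rw [ENNReal.lt_ofReal_iff_toReal_lt hm]
    exact and_iff_left_of_imp fun h => ENNReal.toReal_nonneg.trans_lt h
  · have : {t : ℝ | (m < ENNReal.ofReal t ∧ ENNReal.ofReal t < s) ∧ 0 < t} =
        Set.Ioo m.toReal s.toReal := by
      ext t
      simp only [Set.mem_ofPred_eq, Set.mem_Ioo]
      rw [ENNReal.lt_ofReal_iff_toReal_lt hm]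
      constructor
      · rintro ⟨⟨h1, h2⟩, h3⟩
        exact ⟨h1, (ENNReal.ofReal_lt_iff_lt_toReal h3.le hs).1 h2⟩
      · rintro ⟨h1, h2⟩
        have h3 := ENNReal.toReal_nonneg.trans_lt h1
        exact ⟨⟨h1, (ENNReal.ofReal_lt_iff_lt_toReal h3.le hs).2 h2⟩, h3⟩
    rw [this, Real.volume_Ioo, ENNReal.ofReal_sub _ ENNReal.toReal_nonneg,
      ENNReal.ofReal_toReal hm, ENNReal.ofReal_toReal hs]

/-- The equivalence includes `b = 0` and `b = ∞`; there it relies on the conventions `a / 0 = ∞` for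
`a > 0`, `0 / 0 = 0` and `a / ∞ = 0`. -/
lemma lt_ofReal_inv_mul_iff {t v : ℝ} (ht : 0 < t) (b : ℝ≥0∞) :
    b < ENNReal.ofReal (t⁻¹ * v) ↔ ENNReal.ofReal t < ENNReal.ofReal v / b := by
  have ht' : ENNReal.ofReal t ≠ 0 := by simpa using ht
  rw [inv_mul_eq_div, ENNReal.ofReal_div_of_pos ht,
    ENNReal.lt_div_iff_mul_lt (.inl ht') (.inl ENNReal.ofReal_ne_top),
    ENNReal.lt_div_iff_mul_lt (.inr ENNReal.ofReal_ne_top) (.inr ht'), mul_comm]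

lemma intensity_exceedanceSet [Finite K] [MeasurableSpace K] [DecidableEq K]
    (hκ : ∀ᵐ w ∂κ, ∀ y, 0 ≤ w y) {n : ℕ} (hn : 1 ≤ n) (x : Fin n → K)
    {f : (K → ℝ) × K → ℝ≥0∞} (hf : Measurable f) {z : K → ℝ} (hz : ∀ i, 0 < z (x i)) :
    intensity κ (Prod.mk z ⁻¹' exceedanceSet scaled (Finset.univ.image x) f) =
      ∫⁻ w, ((⨆ y, ENNReal.ofReal (w y) / (ENNReal.ofReal (z y) + f (z, y))) -
        ⨆ i, ENNReal.ofReal (w (x i)) / ENNReal.ofReal (z (x i))) ∂κ := by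
  have : Nonempty (Fin n) := ⟨⟨0, hn⟩⟩
  rw [intensity_apply (measurable_prodMk_left
    (measurableSet_exceedanceSet measurable_scaled _ hf))]
  refine lintegral_congr_ae ?_
  filter_upwards [hκ] with w hw
  -- A strict bound on every term passes to the supremum because it is a maximum over finitely many
  -- indices.
  have hlt : ∀ r : ℝ≥0∞, (⨆ i, ENNReal.ofReal (w (x i)) / ENNReal.ofReal (z (x i))) < r ↔
      ∀ i, ENNReal.ofReal (w (x i)) / ENNReal.ofReal (z (x i)) < r := fun r => by
    refine ⟨fun h i => (le_iSup _ i).trans_lt h, fun h => ?_⟩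
    obtain ⟨i, hi⟩ := exists_eq_ciSup_of_finite
      (f := fun i => ENNReal.ofReal (w (x i)) / ENNReal.ofReal (z (x i)))
    rw [← hi]
    exact h i
  have hm : (⨆ i, ENNReal.ofReal (w (x i)) / ENNReal.ofReal (z (x i))) ≠ ∞ :=
    ((hlt ∞).2 fun i => ENNReal.div_lt_top ENNReal.ofReal_ne_top (by simpa using hz i)).ne
  rw [← volume_ofReal_between hm]
  congr 1
  ext t
  simp only [Set.mem_ofPred_eq, Set.mem_preimage]
  refine and_congr_left fun ht => and_congr ?_ ?_
  · rw [hlt, Finset.forall_mem_image]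
    simp only [Finset.mem_univ, true_imp_iff]
    refine forall_congr' fun i => ?_
    rw [← ENNReal.ofReal_div_of_pos (hz i), ENNReal.ofReal_lt_ofReal_iff ht, scaled,
      inv_mul_eq_div, div_lt_iff₀ ht, div_lt_iff₀ (hz i), mul_comm]
  · rw [lt_iSup_iff]
    exact exists_congr fun y => lt_ofReal_inv_mul_iff ht _

end Intensity

/-! ### Transfer to the given marked Poisson process. -/

section Law

variable {K Ω Ω' : Type*} [MeasurableSpace Ω] [MeasurableSpace Ω']
  {P : Measure Ω} {Q : Measure Ω'}
  {V : Ω' → K → ℝ} {Γ : ℕ → Ω → ℝ} {W : ℕ → Ω → K → ℝ}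

lemma arrival_interarrival {Ω : Type*} {Γ : ℕ → Ω → ℝ} (ω : Ω) (l : ℕ) :
    arrival (fun j => interarrival Γ j ω) l = Γ l ω := by
  induction l with
  | zero => simp [arrival, interarrival]
  | succ l ih =>
    rw [arrival, Finset.sum_range_succ]
    rw [arrival] at ih
    rw [ih, interarrival, add_sub_cancel]

lemma IsMarkedPoisson.measurable_points (h : IsMarkedPoisson Γ W P V Q) :
    Measurable fun ω j => (Γ j ω, W j ω) :=
  measurable_pi_lambda _ fun j => (h.arrivals.measurable j).prodMk (h.measurable j)

lemma IsMarkedPoisson.map_points [IsProbabilityMeasure P] [IsProbabilityMeasure Q]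
    (h : IsMarkedPoisson Γ W P V Q) (hV : Measurable V) :
    P.map (fun ω j => (Γ j ω, W j ω)) =
      (interarrivalLaw.prod (Measure.infinitePi fun _ : ℕ => Q.map V)).map
        fun q l => (arrival q.1 l, q.2 l) := by
  have : IsProbabilityMeasure (Q.map V) := Measure.isProbabilityMeasure_map hV.aemeasurable
  have hmeas : ∀ j, Measurable (interarrival Γ j) := by
    rintro (_ | j)
    · exact h.arrivals.measurable 0
    · exact (h.arrivals.measurable (j + 1)).sub (h.arrivals.measurable j)
  have hE : Measurable fun ω j => interarrival Γ j ω := measurable_pi_lambda _ hmeas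
  have hW : Measurable fun ω j => W j ω := measurable_pi_lambda _ h.measurable
  have h1 : P.map (fun ω j => interarrival Γ j ω) = interarrivalLaw := by
    rw [h.arrivals.indep.map_fun_eq_infinitePi_map hmeas]
    simp_rw [h.arrivals.exponential]
    rfl
  have h2 : P.map (fun ω j => W j ω) = Measure.infinitePi fun _ : ℕ => Q.map V := by
    rw [h.indep_marks.map_fun_eq_infinitePi_map h.measurable]
    simp_rw [h.law]
  have hind : IndepFun (fun ω j => interarrival Γ j ω) (fun ω j => W j ω) P := by
    have hg : Measurable fun (γ : ℕ → ℝ) (j : ℕ) => interarrival (fun i (γ : ℕ → ℝ) => γ i) j γ := by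
      refine measurable_pi_lambda _ ?_
      rintro (_ | j)
      · exact measurable_pi_apply 0
      · exact (measurable_pi_apply (j + 1)).sub (measurable_pi_apply j)
    have heq : (fun ω j => interarrival Γ j ω) =
        (fun (γ : ℕ → ℝ) j => interarrival (fun i (γ : ℕ → ℝ) => γ i) j γ) ∘ fun ω j => Γ j ω := by
      ext ω j
      rcases j with _ | j <;> rfl
    rw [heq]
    exact h.indep_arrivals.comp hg measurable_id
  have hpts : Measurable fun (q : (ℕ → ℝ) × (ℕ → K → ℝ)) (l : ℕ) => (arrival q.1 l, q.2 l) :=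
    measurable_pi_lambda _ fun l =>
      ((measurable_pi_apply l).comp (measurable_arrival.comp measurable_fst)).prodMk
        ((measurable_pi_apply l).comp measurable_snd)
  rw [← h1, ← h2, ← (indepFun_iff_map_prod_eq_prod_map_map hE.aemeasurable hW.aemeasurable).1 hind,
    Measure.map_map hpts (hE.prodMk hW)]
  congr 1
  ext ω l
  · exact (arrival_interarrival ω l).symm
  · rfl

lemma IsMarkedPoisson.isMecke [IsProbabilityMeasure P] [IsProbabilityMeasure Q]
    (h : IsMarkedPoisson Γ W P V Q) (hV : Measurable V) :
    IsMecke (intensity (Q.map V)) (P.map fun ω j => (Γ j ω, W j ω)) := by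
  have : IsProbabilityMeasure (Q.map V) := Measure.isProbabilityMeasure_map hV.aemeasurable
  rw [h.map_points hV]
  exact isMecke_arrival _

lemma IsSpectral.lintegral_eq_one (hV : IsSpectral V Q) (y : K) :
    ∫⁻ w, ENNReal.ofReal (w y) ∂(Q.map V) = 1 := by
  rw [lintegral_map (measurable_pi_apply y).ennreal_ofReal hV.measurable,
    ← ofReal_integral_eq_lintegral_ofReal, hV.mean_one, ENNReal.ofReal_one]
  · by_contra hint
    have := hV.mean_one y
    rw [integral_undef hint] at this
    exact zero_ne_one this
  · filter_upwards [hV.nonneg] with ω hω using hω y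

lemma IsSpectral.ae_map_nonneg [Countable K] (hV : IsSpectral V Q) :
    ∀ᵐ w ∂(Q.map V), ∀ y, 0 ≤ w y := by
  refine (ae_map_iff hV.measurable.aemeasurable ?_).2 hV.nonneg
  simp only [Set.ofPred_forall]
  exact .iInter fun y => measurableSet_le measurable_const (measurable_pi_apply y)

section Points

variable {κ : Measure (K → ℝ)} [IsProbabilityMeasure κ] {M : Measure (ℕ → ℝ × (K → ℝ))}
  [IsProbabilityMeasure M]

lemma IsMecke.ae_isRegularSeq [Countable K] (h : IsMecke (intensity κ) M)
    (hκ : ∀ y, ∫⁻ w, ENNReal.ofReal (w y) ∂κ = 1) : ∀ᵐ p ∂M, IsRegularSeq scaled p := by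
  -- The thresholds `1 / (m + 1)` reduce finiteness at all levels `c > 0` to countably many almost
  -- sure events.
  have h1 : ∀ᵐ p ∂M, ∀ (y : K) (m : ℕ), {j | 1 / ((m : ℝ) + 1) < scaled (p j) y}.Finite :=
    ae_all_iff.2 fun y => ae_all_iff.2 fun m =>
      h.ae_finite (measurableSet_lt measurable_const (measurable_scaled_apply y))
        (intensity_lt_scaled_ne_top (hκ y) (by positivity))
  have h2 : ∀ᵐ p ∂M, ∀ (y : K) j l, 0 < scaled (p j) y → scaled (p j) y = scaled (p l) y → j = l :=
    ae_all_iff.2 fun y => h.ae_no_ties (measurable_scaled_apply y)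
      fun c hc => intensity_scaled_eq y hc
  filter_upwards [h1, h2] with p hp1 hp2
  refine ⟨fun y c hc => ?_, hp2⟩
  obtain ⟨m, hm⟩ := exists_nat_one_div_lt hc
  exact (hp1 y m).subset fun j hj => hm.trans hj

/-- The functions positive at `y` have infinite intensity, so their void probability is `0`. -/
lemma IsMecke.ae_exists_pos [Countable K] (h : IsMecke (intensity κ) M)
    (hκ : ∀ y, ∫⁻ w, ENNReal.ofReal (w y) ∂κ = 1) : ∀ᵐ p ∂M, ∀ y, ∃ l, 0 < scaled (p l) y := by
  refine ae_all_iff.2 fun y => ?_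
  have := h.void (B := {a | 0 < scaled a y})
    (measurableSet_lt measurable_const (measurable_scaled_apply y))
  rw [intensity_scaled_pos (hκ y), expNeg_top] at this
  rw [ae_iff]
  simpa using this

lemma IsMecke.ae_nonneg [Countable K] (h : IsMecke (intensity κ) M)
    (hκ : ∀ᵐ w ∂κ, ∀ y, 0 ≤ w y) : ∀ᵐ p ∂M, ∀ j y, 0 ≤ scaled (p j) y := by
  have hS : MeasurableSet {a : ℝ × (K → ℝ) | ∃ y, scaled a y < 0} := by
    simp only [Set.ofPred_exists]
    exact .iUnion fun y => measurableSet_lt (measurable_scaled_apply y) measurable_const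
  filter_upwards [h.ae_forall hS (intensity_scaled_neg hκ)] with p hp j y
  by_contra! hneg
  exact hp j ⟨y, hneg⟩

end Points

end Law

end MaxStable

/-! ### The distribution of the approximation error. -/

open MaxStable in
theorem mainTheorem5 {K Ω Ω' : Type*}
    [MeasurableSpace K] [MeasurableSingletonClass K]
    [MeasurableSpace Ω] [MeasurableSpace Ω']
    (P : Measure Ω) [IsProbabilityMeasure P] (Q : Measure Ω') [IsProbabilityMeasure Q]
    (N : ℕ) (x : Fin N ≃ K)
    (V : Ω' → K → ℝ) (hV : MaxStable.IsSpectral V Q)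
    (Γ : ℕ → Ω → ℝ) (W : ℕ → Ω → K → ℝ) (hΓW : MaxStable.IsMarkedPoisson Γ W P V Q)
    (n : ℕ) (hn1 : 1 ≤ n) (hn : n ≤ N)
    (f : (K → ℝ) × K → ℝ≥0∞) (hf : Measurable f) :
    P {ω | ∃ y : K,
        f (MaxStable.intermediateField Γ W x n hn ω, y) <
          ENNReal.ofReal |MaxStable.maxStableField Γ W ω y -
            MaxStable.intermediateField Γ W x n hn ω y|} =
      1 - ∫⁻ ω, EReal.exp (-((∫⁻ ω',
          ((⨆ y : K, ENNReal.ofReal (V ω' y) /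
              (ENNReal.ofReal (MaxStable.intermediateField Γ W x n hn ω y) +
                f (MaxStable.intermediateField Γ W x n hn ω, y))) -
            (⨆ i : Fin n, ENNReal.ofReal (V ω' (x (Fin.castLE hn i))) /
              ENNReal.ofReal
                (MaxStable.intermediateField Γ W x n hn ω (x (Fin.castLE hn i))))) ∂Q
          : ℝ≥0∞) : EReal)) ∂P := by
  classical
  have : Finite K := Finite.of_equiv _ x
  have hprob : IsProbabilityMeasure (Q.map V) :=
    Measure.isProbabilityMeasure_map hV.measurable.aemeasurable
  have hpts := hΓW.measurable_points
  have hprobM : IsProbabilityMeasure (P.map fun ω j => (Γ j ω, W j ω)) :=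
    Measure.isProbabilityMeasure_map hpts.aemeasurable
  have hmecke := hΓW.isMecke hV.measurable
  set M := P.map fun ω j => (Γ j ω, W j ω) with hM
  set x' : Fin n → K := fun i => x (Fin.castLE hn i) with hx'
  set I : Finset K := Finset.univ.image x' with hI
  set B := exceedanceSet scaled I f with hB
  have hBm : MeasurableSet B := measurableSet_exceedanceSet measurable_scaled I hf
  have hreg := hmecke.ae_isRegularSeq hV.lintegral_eq_one
  have hpos := hmecke.ae_exists_pos hV.lintegral_eq_one
  have hnn := hmecke.ae_nonneg hV.ae_map_nonneg
  have hhit : Measurable fun p : ℕ → ℝ × (K → ℝ) => hitMax scaled I 0 p :=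
    (measurable_hitMax measurable_scaled I).comp measurable_prodMk_left
  have hSm : MeasurableSet {p : ℕ → ℝ × (K → ℝ) |
      p ∈ voidSet (Prod.mk (hitMax scaled I 0 p) ⁻¹' B)} := by
    have : {p : ℕ → ℝ × (K → ℝ) | p ∈ voidSet (Prod.mk (hitMax scaled I 0 p) ⁻¹' B)} =
        ⋂ j, (fun p => (hitMax scaled I 0 p, p j)) ⁻¹' Bᶜ := by
      ext p; simp [voidSet]
    rw [this]
    exact .iInter fun j => (hhit.prodMk (measurable_pi_apply j)) hBm.compl
  have hmain : M {p | p ∈ voidSet (Prod.mk (hitMax scaled I 0 p) ⁻¹' B)} =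
      ∫⁻ p, expNeg (intensity (Q.map V) (Prod.mk (hitMax scaled I 0 p) ⁻¹' B)) ∂M := by
    -- The induction statement is used at its starting data: nothing is known to be void and the
    -- lower bound is `0`.
    have := hmecke.lintegral_voidSet_hitMax measurable_scaled hreg hBm I
      (fun i hi z a ha => ha.1 i hi) MeasurableSet.empty (z := 0) fun _ => le_rfl
    have huniv : voidSet (∅ : Set (ℝ × (K → ℝ))) = Set.univ := by ext; simp [voidSet]
    simp only [huniv, Set.indicator_univ, Pi.one_apply, one_mul, Set.sdiff_empty] at this
    rw [← this, ← lintegral_indicator_one hSm]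
    rfl
  have hZ : ∀ᵐ ω ∂P, intermediateField Γ W x n hn ω =
      hitMax scaled I 0 fun j => (Γ j ω, W j ω) := by
    filter_upwards [ae_of_ae_map hpts.aemeasurable hreg, ae_of_ae_map hpts.aemeasurable hpos,
      ae_of_ae_map hpts.aemeasurable hnn] with ω h1 h2 h3
    exact h1.extremalMax_eq h3 hn1 x' fun i => h2 _
  have hev : {ω | ∃ y : K, f (intermediateField Γ W x n hn ω, y) <
      ENNReal.ofReal |maxStableField Γ W ω y - intermediateField Γ W x n hn ω y|} =ᵐ[P]
      (fun ω j => (Γ j ω, W j ω)) ⁻¹'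
        {p | p ∈ voidSet (Prod.mk (hitMax scaled I 0 p) ⁻¹' B)}ᶜ := by
    refine Filter.eventuallyEq_set.2 ?_
    filter_upwards [ae_of_ae_map hpts.aemeasurable hreg, ae_of_ae_map hpts.aemeasurable hpos,
      ae_of_ae_map hpts.aemeasurable hnn, hZ] with ω h1 h2 h3 hZ
    have := h1.exists_lt_iff (I := I) (fun i _ => h2 i) h3 f
    rw [← hZ] at this
    refine this.trans ?_
    rw [hZ]
    rfl
  rw [measure_congr hev, ← Measure.map_apply hpts hSm.compl, ← hM, prob_compl_eq_one_sub hSm, hmain]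
  congr 1
  rw [hM, lintegral_map
    (f := fun p => expNeg (intensity (Q.map V) (Prod.mk (hitMax scaled I 0 p) ⁻¹' B)))
    (measurable_expNeg.comp ((measurable_measure_prodMk_left hBm).comp hhit)) hpts]
  refine lintegral_congr_ae ?_
  filter_upwards [ae_of_ae_map hpts.aemeasurable hreg, ae_of_ae_map hpts.aemeasurable hpos,
    hZ] with ω h1 h2 hZ
  rw [← hZ]
  -- Positivity at the chosen points keeps the subtracted maximum finite, which the interval-length
  -- formula requires.
  have hzpos : ∀ i, 0 < intermediateField Γ W x n hn ω (x' i) := by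
    intro i
    have hmem : x' i ∈ I := Finset.mem_image_of_mem _ (Finset.mem_univ i)
    obtain ⟨l, hl⟩ := h2 (x' i)
    rw [hZ]
    exact (hl.trans_le (h1.le_extremalIndex ⟨l, hl⟩ l)).trans_le
      (h1.le_hitMax_of_isHit (h1.isHit_extremalIndex hmem ⟨l, hl⟩) _)
  rw [hB, hI, intensity_exceedanceSet hV.ae_map_nonneg hn1 x' hf hzpos,
    lintegral_map ?_ hV.measurable]
  · rfl
  · have hm : ∀ y, Measurable fun w : K → ℝ => ENNReal.ofReal (w y) := fun y =>
      (measurable_pi_apply y).ennreal_ofReal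
    exact (Measurable.iSup fun y => (hm y).div_const _).sub
      (Measurable.iSup fun i => (hm _).div_const _)
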